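/- A positively elliptic algebra is a graded algebra $H^*=\mathbb{Q}[x_1,\ldots,x_k]/(u_1,\ldots,u_k)$, where the generators $x_i$ have positive even degrees $|x_i|$ and $u_1,\ldots,u_k$ is a regular sequence of homogeneous polynomials, of degrees $|u_i|$. Its formal dimension $\operatorname{fd}H^*$ is the largest $n$ with $H^n\neq 0$. It is said to have a non-trivial subalgebra (or to split) if there are positively elliptic algebras $K^*$ and $Q^*$, each non-zero in some positive degree, and degree-preserving algebra homomorphisms $f\colon K^*\to H^*$, injective, and $g\colon H^*\to Q^*$, surjective, such that $\ker g$ is the ideal of $H^*$ generated by the elements $f(x)$ with $x \in K^*$ homogeneous of positive degree. A derivation of negative degree on $H^*$ is a $\mathbb{Q}$-linear derivation $\delta\colon H^*\to H^*$ for which there is $d>0$ with $\delta(H^n)\subseteq H^{n-d}$ for all $n$ (where $H^i=0$ for $i<0$). Proposition. Let $k\ge 2$ and let $H^*=\mathbb{Q}[x_1,\ldots,x_k]/(u_1,\ldots,u_k)$ be a positively elliptic algebra, presented so that $|x_1|\le\cdots\le|x_k|$, $|u_1|\le\cdots\le|u_k|$, and each $u_i$ is a linear combination of monomials $x_1^{a_1}\cdots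 x_k^{a_k}$ with $a_1+\cdots+a_k\ge 2$. Suppose that $H^*$ has no non-trivial subalgebra, that $\operatorname{fd}H^*\le 20$, that $H^*$ admits a non-zero derivation of negative degree, and that $|x_{k-1}|+|x_k|\ge 12$. Then the degree type $(|x_1|,\ldots,|x_k|;|u_1|,\ldots,|u_k|)$ is $(2,4,6,6;6,8,12,12)$ or $(2,2,6,6;4,8,12,12)$. -/

import Mathlib

/-- A presentation `ℚ[x₁,…,x_k]/(u₁,…,u_k)` of a positively elliptic algebra: the generators have
positive even degrees, and the relations are homogeneous and form a regular sequence. The indices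
`1,…,k` of the text are the elements `0,…,k-1` of `Fin k` here. -/
structure PositivelyElliptic (k : ℕ) where
  /-- the degree `|x_i|` of the `i`-th generator -/
  deg : Fin k → ℕ
  /-- the relation `u_i` -/
  rel : Fin k → MvPolynomial (Fin k) ℚ
  /-- the degree `|u_i|` of the `i`-th relation -/
  relDeg : Fin k → ℕ
  deg_pos : ∀ i, 0 < deg i
  deg_even : ∀ i, Even (deg i)
  rel_homogeneous : ∀ i, (rel i).IsWeightedHomogeneous deg (relDeg i)
  /-- each `u_i` is a non-zero-divisor modulo `(u_1, …, u_{i-1})` -/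
  rel_regular :
    RingTheory.Sequence.IsWeaklyRegular (MvPolynomial (Fin k) ℚ) (List.ofFn rel)

namespace PositivelyElliptic

variable {k : ℕ}

/-- The algebra `H^* = ℚ[x₁,…,x_k]/(u₁,…,u_k)`. -/
abbrev Alg (H : PositivelyElliptic k) : Type :=
  MvPolynomial (Fin k) ℚ ⧸ Ideal.span (Set.range H.rel)

/-- The graded piece `H^n`: the image in `H^*` of the span of the monomials
`x₁^{a₁} ⋯ x_k^{a_k}` with `a₁|x₁| + … + a_k|x_k| = n`. -/
noncomputable def piece (H : PositivelyElliptic k) (n : ℕ) : Submodule ℚ H.Alg :=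
  (MvPolynomial.weightedHomogeneousSubmodule ℚ H.deg n).map
    (Ideal.Quotient.mkₐ ℚ (Ideal.span (Set.range H.rel))).toLinearMap

/-- The presentation is a pure model: the generators and the relations are ordered by degree, and
each relation is a combination of monomials `x₁^{a₁} ⋯ x_k^{a_k}` with `a₁ + … + a_k ≥ 2`.
(The inequalities `|u_i| ≥ 2|x_i|` follow from these conditions, so they are not required.) -/
structure IsPureModel (H : PositivelyElliptic k) : Prop where
  deg_mono : Monotone H.deg
  relDeg_mono : Monotone H.relDeg
  two_le : ∀ i, ∀ a ∈ (H.rel i).support, 2 ≤ a.degree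

/-- The degree type `(|x₁|,…,|x_k|; |u₁|,…,|u_k|)`. -/
def degreeType (H : PositivelyElliptic k) : List ℕ × List ℕ :=
  (List.ofFn H.deg, List.ofFn H.relDeg)

/-- `n` is the formal dimension of `H^*`: the largest degree in which `H^*` is non-zero. -/
def IsFormalDimension (H : PositivelyElliptic k) (n : ℕ) : Prop :=
  IsGreatest {i : ℕ | H.piece i ≠ ⊥} n

/-- `δ` has degree `-d`: it maps `H^{m+d}` into `H^m`, and it maps `H^n` into `0` for `n < d`.
Since `H^*` is concentrated in even degrees, the sign `(-1)^{|δ||x|}` in the graded Leibniz rule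
is `1` for all homogeneous `x ≠ 0`, so that graded derivations are ordinary derivations. -/
def LowersDegreeBy (H : PositivelyElliptic k) (δ : Derivation ℚ H.Alg H.Alg) (d : ℕ) : Prop :=
  (∀ m, ∀ x ∈ H.piece (m + d), δ x ∈ H.piece m) ∧ ∀ n < d, ∀ x ∈ H.piece n, δ x = 0

/-- `H^*` admits a non-zero derivation of negative degree. -/
def HasNegativeDerivation (H : PositivelyElliptic k) : Prop :=
  ∃ d : ℕ, 0 < d ∧ ∃ δ : Derivation ℚ H.Alg H.Alg, H.LowersDegreeBy δ d ∧ δ ≠ 0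

/-- `H^*` is non-zero in some positive degree (so it is neither `0` nor `ℚ`). -/
def IsNontrivial (H : PositivelyElliptic k) : Prop :=
  ∃ n, 0 < n ∧ H.piece n ≠ ⊥

/-- `H^*` splits, that is, it has a non-trivial (positively elliptic) subalgebra: there are
non-trivial positively elliptic algebras `K^*` and `Q^*` and an exact sequence
`0 → K^* → H^* → Q^* → 0` of graded algebras. Exactness means that `f` is injective, that `g` is
surjective, and that the kernel of `g` is the ideal generated by the elements of positive degree
of `K^*`, so that `Q^*` is the quotient algebra `H^*/K^*`. -/
def Splits (H : PositivelyElliptic k) : Prop :=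
  ∃ (l m : ℕ) (K : PositivelyElliptic l) (Q : PositivelyElliptic m)
    (f : K.Alg →ₐ[ℚ] H.Alg) (g : H.Alg →ₐ[ℚ] Q.Alg),
    K.IsNontrivial ∧ Q.IsNontrivial ∧
    (∀ n, ∀ x ∈ K.piece n, f x ∈ H.piece n) ∧
    (∀ n, ∀ x ∈ H.piece n, g x ∈ Q.piece n) ∧
    Function.Injective f ∧ Function.Surjective g ∧
    RingHom.ker g = Ideal.span {y | ∃ n, 0 < n ∧ ∃ x ∈ K.piece n, f x = y}

end PositivelyElliptic

/-! Write a_i = |x_i| and b_i = |u_i|, with indices starting at 0. Three facts control the degrees.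

The Hilbert series of a complete intersection is ∏(1 - X^{b_i}) / ∏(1 - X^{a_i}), so the formal
dimension is N = Σ b_i - Σ a_i (`formalDimension_add_sum`). By Krull's height theorem, any set of r
variables admits at least r relations that contain a monomial in these variables alone
(`exists_relations_of_variables`); since all monomials have length at least 2, this gives b_i ≥
2a_i. Finally, if u_0, …, u_l involve only x_0, …, x_l with l < k - 1, then these variables generate
a non-trivial subalgebra (`splits_of_support`). Without such a subalgebra some monomial of length at
least 2 in u_0, …, u_l contains a later variable, which forces b_l ≥ a_0 + a_{l+1}.

For k ≥ 5 these inequalities give N > 20 (`false_of_five_le`). For k = 4 they leave just the two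
stated degree types, once it is also used that one of u_0, u_1, u_2 contains a monomial in x_2, x_3
only (`degrees_of_four_generators`).

For k = 2 and k = 3 every derivation of negative degree vanishes. It lifts to a homogeneous
derivation D = Σ p_i ∂_i of the polynomial ring preserving the ideal of relations (`exists_lift`).
For degree reasons p_0 = 0 and D u_0 = 0. For k = 2 this reads p_1 ∂_1 u_0 = 0, so D = 0 or u_0
involves only x_0 and the algebra splits. For k = 3 the degree bounds, or a linear change of x_1,
x_2 when a_1 = a_2, reduce to D = q ∂_2 with u_0 and q free of x_2. A divisibility argument over
ℚ[x_0, x_1] then puts q into the ideal of relations (`mem_span_pair_of_derivative`,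
`last_mem_of_mkDerivation_mem`).

The splitting criterion rests on flatness. Let A = ℚ[x_0, …, x_{l-1}]/(u_0, …, u_{l-1}), whose
augmentation ideal is maximal and nilpotent. A sequence that is regular on the free A-algebra A[x_l,
…, x_{k-1}] has projective quotients over A and stays regular modulo the maximal ideal
(`projective_quotient_regularFamily`). Regularity modulo the maximal ideal makes the quotient
algebra positively elliptic, and projectivity makes the subalgebra embed. -/

section

open MvPolynomial

/-! ### Regular sequences indexed by `Fin m` -/

/-- Each `f i` is a non-zero-divisor modulo the ideal generated by the `f j` with `j < i`. -/
def RegularFamily {R : Type*} [CommRing R] {m : ℕ} (f : Fin m → R) : Prop :=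
  ∀ i p, f i * p ∈ Ideal.span (f '' Set.Iio i) → p ∈ Ideal.span (f '' Set.Iio i)

theorem ofList_take_ofFn {R : Type*} [CommRing R] {m : ℕ} (f : Fin m → R) (i : Fin m) :
    Ideal.ofList ((List.ofFn f).take i) = Ideal.span (f '' Set.Iio i) := by
  unfold Ideal.ofList
  congr 1
  ext r
  simp only [Set.mem_ofPred_eq, List.mem_take_iff_getElem, Set.mem_image, Set.mem_Iio]
  constructor
  · rintro ⟨j, hj, rfl⟩
    simp only [List.length_ofFn, lt_min_iff] at hj
    exact ⟨⟨j, hj.2⟩, hj.1, by simp⟩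
  · rintro ⟨j, hj, rfl⟩
    exact ⟨j, by simpa using hj, by simp⟩

theorem isWeaklyRegular_ofFn_iff {R : Type*} [CommRing R] {m : ℕ} (f : Fin m → R) :
    RingTheory.Sequence.IsWeaklyRegular R (List.ofFn f) ↔ RegularFamily f := by
  rw [RingTheory.Sequence.isWeaklyRegular_iff]
  have key : ∀ i : Fin m, IsSMulRegular
      (R ⧸ (Ideal.ofList ((List.ofFn f).take i) • ⊤ : Submodule R R)) (f i) ↔
      ∀ p, f i * p ∈ Ideal.span (f '' Set.Iio i) → p ∈ Ideal.span (f '' Set.Iio i) := by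
    intro i
    rw [isSMulRegular_quotient_iff_mem_of_smul_mem, ofList_take_ofFn]
    simp
  constructor
  · intro h i
    have := h i (by simp)
    rw [List.getElem_ofFn] at this
    exact (key i).1 this
  · intro h i hi
    rw [List.getElem_ofFn]
    exact (key ⟨i, by simpa using hi⟩).2 (h _)

/-! ### Hilbert series of complete intersections -/

section Hilbert

variable {σ : Type*}

/-- The degree `n` part of `ℚ[x] / J`. -/
noncomputable def quotPiece (w : σ → ℕ) (J : Ideal (MvPolynomial σ ℚ)) (n : ℕ) :
    Submodule ℚ (MvPolynomial σ ℚ ⧸ J) :=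
  (weightedHomogeneousSubmodule ℚ w n).map (Ideal.Quotient.mkₐ ℚ J).toLinearMap

/-- `J` contains the homogeneous components of its elements. -/
def HomogIdeal (w : σ → ℕ) (J : Ideal (MvPolynomial σ ℚ)) : Prop :=
  ∀ p ∈ J, ∀ n, weightedHomogeneousComponent w n p ∈ J

theorem finiteDimensional_quotPiece [Finite σ] {w : σ → ℕ} (hw : ∀ i, w i ≠ 0)
    (J : Ideal (MvPolynomial σ ℚ)) (n : ℕ) : FiniteDimensional ℚ (quotPiece w J n) :=
  Module.Finite.iff_fg.2 ((weightedHomogeneousSubmodule_fg ℚ w hw n).map _)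

theorem mem_quotPiece {w : σ → ℕ} {J : Ideal (MvPolynomial σ ℚ)} {n : ℕ}
    {x : MvPolynomial σ ℚ ⧸ J} :
    x ∈ quotPiece w J n ↔ ∃ p, IsWeightedHomogeneous w p n ∧ Ideal.Quotient.mk J p = x := by
  simp [quotPiece, Submodule.mem_map, mem_weightedHomogeneousSubmodule]

theorem component_mul_of_homogeneous {w : σ → ℕ} {u c : MvPolynomial σ ℚ} {b n : ℕ}
    (hu : IsWeightedHomogeneous w u b) :
    weightedHomogeneousComponent w n (u * c) =
      if b ≤ n then u * weightedHomogeneousComponent w (n - b) c else 0 := by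
  classical
  have hterm : ∀ i, weightedHomogeneousComponent w n (u * weightedHomogeneousComponent w i c) =
      if b + i = n then u * weightedHomogeneousComponent w i c else 0 := by
    intro i
    split_ifs with h
    · exact (h ▸ hu.mul (weightedHomogeneousComponent_isWeightedHomogeneous i c)
        : IsWeightedHomogeneous w _ n).weightedHomogeneousComponent_same
    · exact IsWeightedHomogeneous.weightedHomogeneousComponent_ne n
        (hu.mul (weightedHomogeneousComponent_isWeightedHomogeneous i c)) (by simpa [eq_comm] using h)
  have hfin := weightedHomogeneousComponent_finsupp (w := w) c
  have e1 : u * c = ∑ i ∈ hfin.toFinset, u * weightedHomogeneousComponent w i c := by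
    rw [← Finset.mul_sum, ← finsum_eq_sum _ hfin, finsum_weightedHomogeneousComponent]
  rw [e1, map_sum, Finset.sum_congr rfl (fun i _ => hterm i)]
  split_ifs with hb
  · rw [Finset.sum_eq_single (n - b)]
    · rw [if_pos (by omega)]
    · intro i _ hi
      rw [if_neg (by omega)]
    · intro hi
      have : weightedHomogeneousComponent w (n - b) c = 0 := by
        by_contra h0
        exact hi ((Set.Finite.mem_toFinset hfin).2 h0)
      simp [this]
  · exact Finset.sum_eq_zero fun i _ => if_neg (by omega)

theorem HomogIdeal.sup_span {w : σ → ℕ} {J : Ideal (MvPolynomial σ ℚ)} (hJ : HomogIdeal w J)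
    {u : MvPolynomial σ ℚ} {b : ℕ} (hu : IsWeightedHomogeneous w u b) :
    HomogIdeal w (J ⊔ Ideal.span {u}) := by
  intro p hp n
  obtain ⟨j, hj, v, hv, rfl⟩ := Submodule.mem_sup.1 hp
  obtain ⟨c, rfl⟩ := Ideal.mem_span_singleton'.1 hv
  rw [map_add, mul_comm, component_mul_of_homogeneous hu]
  refine add_mem (Ideal.mem_sup_left (hJ j hj n)) (Ideal.mem_sup_right ?_)
  split_ifs
  · exact Ideal.mul_mem_right _ _ (Ideal.mem_span_singleton_self u)
  · exact zero_mem _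

theorem HomogIdeal.span_of_finite {ι : Type*} {w : σ → ℕ} {s : Set ι} (hs : s.Finite)
    {f : ι → MvPolynomial σ ℚ} {b : ι → ℕ} (hf : ∀ i, IsWeightedHomogeneous w (f i) (b i)) :
    HomogIdeal w (Ideal.span (f '' s)) := by
  induction s, hs using Set.Finite.induction_on with
  | empty =>
    intro p hp n
    simp only [Set.image_empty, Ideal.span_empty, Ideal.mem_bot] at hp ⊢
    rw [hp, map_zero]
  | @insert a s _ _ ih =>
    rw [Set.image_insert_eq, Ideal.span_insert, sup_comm]
    exact ih.sup_span (hf a)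

/-- The dimension of the degree `n` part of `ℚ[x] / J`. -/
noncomputable def hilb (w : σ → ℕ) (J : Ideal (MvPolynomial σ ℚ)) (n : ℕ) : ℕ :=
  Module.finrank ℚ (quotPiece w J n)

/-- With A = ℚ[x]/J, multiplication by u gives a short exact sequence 0 → A_{n-b} → A_n → (A/uA)_n →
0; regularity is the injectivity on the left. The conditional covers n < b, where the left term is
absent. -/
theorem hilb_sup_span [Finite σ] {w : σ → ℕ} (hw : ∀ i, w i ≠ 0)
    {J : Ideal (MvPolynomial σ ℚ)} (hJ : HomogIdeal w J)
    {u : MvPolynomial σ ℚ} {b : ℕ} (hu : IsWeightedHomogeneous w u b)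
    (hreg : ∀ p, u * p ∈ J → p ∈ J) (n : ℕ) :
    hilb w (J ⊔ Ideal.span {u}) n + (if b ≤ n then hilb w J (n - b) else 0) = hilb w J n := by
  have := finiteDimensional_quotPiece hw J n
  set J' := J ⊔ Ideal.span {u} with hJ'
  have hle : J ≤ J' := le_sup_left
  let F : (MvPolynomial σ ℚ ⧸ J) →ₗ[ℚ] (MvPolynomial σ ℚ ⧸ J') :=
    (Ideal.Quotient.factorₐ ℚ hle).toLinearMap
  let f : quotPiece w J n →ₗ[ℚ] (MvPolynomial σ ℚ ⧸ J') := F ∘ₗ (quotPiece w J n).subtype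
  have hF : ∀ p, F (Ideal.Quotient.mk J p) = Ideal.Quotient.mk J' p := fun p => rfl
  have hrange : LinearMap.range f = quotPiece w J' n := by
    ext x
    constructor
    · rintro ⟨⟨y, hy⟩, rfl⟩
      obtain ⟨p, hp, rfl⟩ := mem_quotPiece.1 hy
      exact mem_quotPiece.2 ⟨p, hp, rfl⟩
    · intro hx
      obtain ⟨p, hp, rfl⟩ := mem_quotPiece.1 hx
      exact ⟨⟨_, mem_quotPiece.2 ⟨p, hp, rfl⟩⟩, rfl⟩
  have hker : Module.finrank ℚ (LinearMap.ker f) = if b ≤ n then hilb w J (n - b) else 0 := by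
    -- Homogeneity of J allows passing to the degree n component of p = j + u c. The second
    -- alternative is the case n < b, where the multiple of u has no such component.
    have hkermem : ∀ x : quotPiece w J n, f x = 0 → ∃ c, b ≤ n ∧ IsWeightedHomogeneous w c (n - b) ∧
        Ideal.Quotient.mk J (u * c) = x ∨ (x : MvPolynomial σ ℚ ⧸ J) = 0 := by
      rintro ⟨x, hx⟩ h0
      obtain ⟨p, hp, rfl⟩ := mem_quotPiece.1 hx
      have hpJ : p ∈ J' := Ideal.Quotient.eq_zero_iff_mem.1 h0
      obtain ⟨j, hj, v, hv, hjv⟩ := Submodule.mem_sup.1 hpJ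
      obtain ⟨c, rfl⟩ := Ideal.mem_span_singleton'.1 hv
      refine ⟨weightedHomogeneousComponent w (n - b) c, ?_⟩
      have e := congrArg (weightedHomogeneousComponent w n) hjv
      rw [hp.weightedHomogeneousComponent_same, map_add, mul_comm,
        component_mul_of_homogeneous hu] at e
      by_cases hb : b ≤ n
      · left
        refine ⟨hb, weightedHomogeneousComponent_isWeightedHomogeneous _ _, ?_⟩
        rw [if_pos hb] at e
        show _ = Ideal.Quotient.mk J p
        rw [← e, map_add, Ideal.Quotient.eq_zero_iff_mem.2 (hJ j hj n), zero_add]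
      · right
        rw [if_neg hb, add_zero] at e
        show Ideal.Quotient.mk J p = 0
        rw [← e, Ideal.Quotient.eq_zero_iff_mem.2 (hJ j hj n)]
    split_ifs with hb
    · have hmul : ∀ y ∈ quotPiece w J (n - b), Ideal.Quotient.mk J u * y ∈ quotPiece w J n := by
        intro y hy
        obtain ⟨p, hp, rfl⟩ := mem_quotPiece.1 hy
        refine mem_quotPiece.2 ⟨u * p, ?_, map_mul _ _ _⟩
        have := hu.mul hp
        rwa [Nat.add_sub_cancel' hb] at this
      let g : quotPiece w J (n - b) →ₗ[ℚ] quotPiece w J n :=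
        (LinearMap.mulLeft ℚ (Ideal.Quotient.mk J u)).restrict hmul
      have hg : Function.Injective g := by
        rw [injective_iff_map_eq_zero]
        rintro ⟨y, hy⟩ h0
        obtain ⟨p, hp, rfl⟩ := mem_quotPiece.1 hy
        have h1 : Ideal.Quotient.mk J (u * p) = 0 := by
          rw [map_mul]; exact congrArg Subtype.val h0
        exact Subtype.ext (Ideal.Quotient.eq_zero_iff_mem.2
          (hreg p (Ideal.Quotient.eq_zero_iff_mem.1 h1)))
      have hgr : LinearMap.range g = LinearMap.ker f := by
        ext x
        constructor
        · rintro ⟨⟨y, hy⟩, rfl⟩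
          obtain ⟨p, hp, rfl⟩ := mem_quotPiece.1 hy
          show Ideal.Quotient.mk J' (u * p) = 0
          exact Ideal.Quotient.eq_zero_iff_mem.2 (Ideal.mem_sup_right
            (Ideal.mul_mem_right _ _ (Ideal.mem_span_singleton_self u)))
        · intro hx
          obtain ⟨c, ⟨_, hc, hcx⟩ | hx0⟩ := hkermem x hx
          · exact ⟨⟨_, mem_quotPiece.2 ⟨c, hc, rfl⟩⟩, Subtype.ext ((map_mul _ _ _).symm.trans hcx)⟩
          · exact ⟨0, by rw [map_zero]; exact Subtype.ext hx0.symm⟩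
      rw [← hgr, LinearMap.finrank_range_of_inj hg, hilb]
    · have : LinearMap.ker f = ⊥ := by
        rw [eq_bot_iff]
        intro x hx
        obtain ⟨c, ⟨hb', _⟩ | hx0⟩ := hkermem x hx
        · exact absurd hb' hb
        · exact Subtype.ext hx0
      rw [this, finrank_bot]
  rw [← hker, hilb, ← hrange]
  exact LinearMap.finrank_range_add_finrank_ker f

/-- The Hilbert series of `ℚ[x] / J`. -/
noncomputable def hilbSeries (w : σ → ℕ) (J : Ideal (MvPolynomial σ ℚ)) : PowerSeries ℤ :=
  PowerSeries.mk fun n => (hilb w J n : ℤ)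

theorem hilbSeries_sup_span [Finite σ] {w : σ → ℕ} (hw : ∀ i, w i ≠ 0)
    {J : Ideal (MvPolynomial σ ℚ)} (hJ : HomogIdeal w J)
    {u : MvPolynomial σ ℚ} {b : ℕ} (hu : IsWeightedHomogeneous w u b)
    (hreg : ∀ p, u * p ∈ J → p ∈ J) :
    hilbSeries w (J ⊔ Ideal.span {u}) = (1 - PowerSeries.X ^ b) * hilbSeries w J := by
  ext n
  rw [sub_mul, one_mul, map_sub, PowerSeries.coeff_X_pow_mul']
  simp only [hilbSeries, PowerSeries.coeff_mk]
  rw [← hilb_sup_span hw hJ hu hreg n]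
  push_cast
  ring

theorem hilbSeries_span_range [Finite σ] {w : σ → ℕ} (hw : ∀ i, w i ≠ 0) {m : ℕ}
    {f : Fin m → MvPolynomial σ ℚ} {b : Fin m → ℕ}
    (hf : ∀ i, IsWeightedHomogeneous w (f i) (b i)) (hreg : RegularFamily f) :
    hilbSeries w (Ideal.span (Set.range f)) =
      (∏ i, (1 - PowerSeries.X ^ b i)) * hilbSeries w ⊥ := by
  have key : ∀ n ≤ m, hilbSeries w (Ideal.span (f '' {i : Fin m | (i : ℕ) < n})) =
      (∏ i with (i : Fin m).val < n, (1 - PowerSeries.X ^ b i)) * hilbSeries w ⊥ := by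
    intro n
    induction n with
    | zero => intro _; simp
    | succ n ih =>
      intro hn
      have e1 : {i : Fin m | (i : ℕ) < n + 1} =
          insert (⟨n, hn⟩ : Fin m) {i : Fin m | (i : ℕ) < n} := by
        ext i; simp [Fin.ext_iff]; omega
      have e2 : (Finset.univ.filter fun i : Fin m => (i : ℕ) < n + 1) =
          insert (⟨n, hn⟩ : Fin m) (Finset.univ.filter fun i : Fin m => (i : ℕ) < n) := by
        ext i; simp [Fin.ext_iff]; omega
      have e3 : Set.Iio (⟨n, hn⟩ : Fin m) = {i : Fin m | (i : ℕ) < n} := by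
        ext i; simp [Fin.lt_def]
      rw [e1, Set.image_insert_eq, Ideal.span_insert, sup_comm, e2,
        Finset.prod_insert (by simp), mul_assoc, ← ih (by omega)]
      refine hilbSeries_sup_span hw (HomogIdeal.span_of_finite (Set.toFinite _) hf) (hf _) ?_
      have := hreg ⟨n, hn⟩
      rwa [e3] at this
  have := key m le_rfl
  simpa using this

/-- Membership in an ideal generated by variables is tested on each monomial separately, and
multiplying by another variable does not change the relevant exponents. The variables serve as a
second regular sequence, from which the Hilbert series of the polynomial ring itself is obtained. -/
theorem regularFamily_X (k : ℕ) : RegularFamily (fun i : Fin k => (X i : MvPolynomial (Fin k) ℚ)) := by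
  intro i p hp
  rw [mem_ideal_span_X_image] at hp ⊢
  intro d hd
  have : d + Finsupp.single i 1 ∈ (X i * p).support := by
    rw [mem_support_iff, mul_comm, coeff_mul_X]
    exact mem_support_iff.1 hd
  obtain ⟨j, hj, hne⟩ := hp _ this
  refine ⟨j, hj, ?_⟩
  have hji : i ≠ j := (Set.mem_Iio.1 hj).ne'
  simpa [Finsupp.single_apply, hji] using hne

theorem hilbSeries_span_X {k : ℕ} (w : Fin k → ℕ) :
    hilbSeries w (Ideal.span (Set.range fun i : Fin k => (X i : MvPolynomial (Fin k) ℚ))) = 1 := by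
  have hmem : ∀ p : MvPolynomial (Fin k) ℚ,
      p ∈ Ideal.span (Set.range fun i : Fin k => (X i : MvPolynomial (Fin k) ℚ)) ↔
        constantCoeff p = 0 := by
    intro p
    rw [← Set.image_univ, mem_ideal_span_X_image]
    simp only [Set.mem_univ, true_and, mem_support_iff]
    constructor
    · intro h
      by_contra h0
      obtain ⟨i, hi⟩ := h 0 h0
      exact hi rfl
    · intro h d hd
      by_contra! h0
      obtain rfl : d = 0 := Finsupp.ext h0
      exact hd h
  set J := Ideal.span (Set.range fun i : Fin k => (X i : MvPolynomial (Fin k) ℚ))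
  ext n
  rw [hilbSeries, PowerSeries.coeff_mk, PowerSeries.coeff_one]
  split_ifs with hn
  · subst hn
    have : quotPiece w J 0 = Submodule.span ℚ {1} := by
      apply le_antisymm
      · intro x hx
        obtain ⟨p, hp, rfl⟩ := mem_quotPiece.1 hx
        refine Submodule.mem_span_singleton.2 ⟨constantCoeff p, ?_⟩
        have : p - C (constantCoeff p) ∈ J := (hmem _).2 (by simp)
        have h2 : Ideal.Quotient.mk J p = Ideal.Quotient.mk J (C (constantCoeff p)) :=
          Ideal.Quotient.eq.2 this
        rw [h2]
        exact (Algebra.algebraMap_eq_smul_one (A := MvPolynomial (Fin k) ℚ ⧸ J) _).symm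
      · rw [Submodule.span_singleton_le_iff_mem]
        exact mem_quotPiece.2 ⟨1, isWeightedHomogeneous_one ℚ w, map_one _⟩
    have h1 : (1 : MvPolynomial (Fin k) ℚ ⧸ J) ≠ 0 := by
      intro h
      have := (hmem 1).1 (Ideal.Quotient.eq_zero_iff_mem.1 (by rw [map_one]; exact h))
      simp at this
    rw [hilb, this, finrank_span_singleton h1, Nat.cast_one]
  · have : quotPiece w J n = ⊥ := by
      rw [eq_bot_iff]
      intro x hx
      obtain ⟨p, hp, rfl⟩ := mem_quotPiece.1 hx
      refine (Submodule.mem_bot ℚ).2 (Ideal.Quotient.eq_zero_iff_mem.2 ((hmem p).2 ?_))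
      exact hp.coeff_eq_zero 0 (by simpa using Ne.symm hn)
    rw [hilb, this, finrank_bot, Nat.cast_zero]

/-- The Hilbert series of a complete intersection. -/
theorem prod_mul_hilbSeries {k m : ℕ} {w : Fin k → ℕ} (hw : ∀ i, w i ≠ 0)
    {f : Fin m → MvPolynomial (Fin k) ℚ} {b : Fin m → ℕ}
    (hf : ∀ i, IsWeightedHomogeneous w (f i) (b i)) (hreg : RegularFamily f) :
    (∏ i, (1 - PowerSeries.X ^ w i)) * hilbSeries w (Ideal.span (Set.range f)) =
      ∏ i, (1 - PowerSeries.X ^ b i) := by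
  -- Dividing by all variables leaves ℚ, of Hilbert series 1, so ∏(1 - X^{w_i}) is inverse to the
  -- Hilbert series of the polynomial ring. No monomials have to be counted.
  have h1 := hilbSeries_span_range hw (fun i => isWeightedHomogeneous_X ℚ w i) (regularFamily_X k)
  rw [hilbSeries_span_X w] at h1
  rw [hilbSeries_span_range hw hf hreg, mul_left_comm, ← h1, mul_one]

end Hilbert

/-! ### Finiteness and formal dimension -/

/-- `1 + X + ⋯ + X^(n-1)` -/
noncomputable def geomPoly (n : ℕ) : Polynomial ℤ := ∑ i ∈ Finset.range n, Polynomial.X ^ i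

theorem one_sub_mul_geomPoly (n : ℕ) :
    (1 - Polynomial.X) * geomPoly n = (1 - Polynomial.X ^ n : Polynomial ℤ) :=
  mul_neg_geom_sum _ n

theorem coeff_geomPoly (n i : ℕ) : (geomPoly n).coeff i = if i < n then 1 else 0 := by
  simp [geomPoly, Polynomial.coeff_X_pow]

theorem natDegree_geomPoly {n : ℕ} (hn : n ≠ 0) : (geomPoly n).natDegree + 1 = n := by
  have h : (geomPoly n).natDegree = n - 1 := by
    refine Polynomial.natDegree_eq_of_le_of_coeff_ne_zero ?_ ?_
    · rw [Polynomial.natDegree_le_iff_coeff_eq_zero]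
      intro i hi
      rw [coeff_geomPoly, if_neg (by omega)]
    · rw [coeff_geomPoly, if_pos (by omega)]
      exact one_ne_zero
  omega

theorem geomPoly_ne_zero {n : ℕ} (hn : n ≠ 0) : geomPoly n ≠ 0 := by
  intro h
  have := coeff_geomPoly n 0
  rw [h, if_pos (by omega)] at this
  simp at this

theorem coeff_prod_geomPoly_nonneg {ι : Type*} (s : Finset ι) (a : ι → ℕ) (n : ℕ) :
    0 ≤ (∏ i ∈ s, geomPoly (a i)).coeff n := by
  classical
  induction s using Finset.induction generalizing n with
  | empty => rw [Finset.prod_empty, Polynomial.coeff_one]; split_ifs <;> simp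
  | insert i s hi ih =>
    rw [Finset.prod_insert hi, Polynomial.coeff_mul]
    refine Finset.sum_nonneg fun x _ => mul_nonneg ?_ (ih _)
    rw [coeff_geomPoly]; split_ifs <;> simp

section Hilbert

variable {k : ℕ} {w : Fin k → ℕ} {f : Fin k → MvPolynomial (Fin k) ℚ} {b : Fin k → ℕ}

/-- There are as many relations as variables, so the factor (1 - X)^k cancels on both sides. What
remains involves polynomials with non-negative coefficients and constant term 1 or 0, which allows
comparison of coefficients and of degrees. -/
theorem geomPoly_mul_hilbSeries (hw : ∀ i, w i ≠ 0)
    (hf : ∀ i, IsWeightedHomogeneous w (f i) (b i)) (hreg : RegularFamily f) :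
    ((∏ i, geomPoly (w i) : Polynomial ℤ) : PowerSeries ℤ) *
      hilbSeries w (Ideal.span (Set.range f)) =
      ((∏ i, geomPoly (b i) : Polynomial ℤ) : PowerSeries ℤ) := by
  have key : ∀ a : Fin k → ℕ, (∏ i, (1 - PowerSeries.X ^ a i) : PowerSeries ℤ) =
      (1 - PowerSeries.X) ^ k * ((∏ i, geomPoly (a i) : Polynomial ℤ) : PowerSeries ℤ) := by
    intro a
    have : (∏ i, (1 - Polynomial.X ^ a i) : Polynomial ℤ) =
        (1 - Polynomial.X) ^ k * ∏ i, geomPoly (a i) := by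
      rw [← Finset.prod_congr rfl fun i _ => one_sub_mul_geomPoly (a i), Finset.prod_mul_distrib,
        Finset.prod_const, Finset.card_univ, Fintype.card_fin]
    have h2 := congrArg (Polynomial.coeToPowerSeries.ringHom (R := ℤ)) this
    simpa [map_prod] using h2
  have h := prod_mul_hilbSeries hw hf hreg
  rw [key w, key b, mul_assoc] at h
  refine mul_left_cancel₀ (pow_ne_zero k ?_) h
  intro h0
  have := congrArg (PowerSeries.coeff 0) h0
  simp at this

theorem exists_quotPiece_eq_bot (hw : ∀ i, w i ≠ 0)
    (hf : ∀ i, IsWeightedHomogeneous w (f i) (b i)) (hreg : RegularFamily f) :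
    ∃ B, ∀ n, B < n → quotPiece w (Ideal.span (Set.range f)) n = ⊥ := by
  refine ⟨(∏ i, geomPoly (b i)).natDegree, fun n hn => ?_⟩
  have := finiteDimensional_quotPiece hw (Ideal.span (Set.range f)) n
  rw [← Submodule.finrank_eq_zero (R := ℚ)]
  have h := congrArg (PowerSeries.coeff n) (geomPoly_mul_hilbSeries hw hf hreg)
  rw [Polynomial.coeff_coe, Polynomial.coeff_eq_zero_of_natDegree_lt hn,
    PowerSeries.coeff_mul] at h
  -- Beyond the degree of the right side, a sum of non-negative terms vanishes. The term (0, n) is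
  -- the dimension of the degree n piece, since the first factor has constant coefficient 1.
  have hnn : ∀ x ∈ Finset.HasAntidiagonal.antidiagonal n,
      0 ≤ PowerSeries.coeff x.1 ((∏ i, geomPoly (w i) : Polynomial ℤ) : PowerSeries ℤ) *
        PowerSeries.coeff x.2 (hilbSeries w (Ideal.span (Set.range f))) := by
    intro x _
    rw [Polynomial.coeff_coe, hilbSeries, PowerSeries.coeff_mk]
    exact mul_nonneg (coeff_prod_geomPoly_nonneg _ _ _) (Int.natCast_nonneg _)
  have h0 := (Finset.sum_eq_zero_iff_of_nonneg hnn).1 h (0, n) (by simp)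
  rw [Polynomial.coeff_coe, hilbSeries, PowerSeries.coeff_mk, Polynomial.coeff_zero_prod] at h0
  simp only [coeff_geomPoly, Nat.pos_of_ne_zero (hw _), if_true, Finset.prod_const_one,
    one_mul] at h0
  exact_mod_cast h0

/-- Compare degrees in the polynomial identity: the Hilbert polynomial has degree N and `geomPoly n`
has degree n - 1. The corrections by 1 cancel, as there are k factors on each side. -/
theorem formalDimension_add_sum (hw : ∀ i, w i ≠ 0)
    (hf : ∀ i, IsWeightedHomogeneous w (f i) (b i)) (hreg : RegularFamily f)
    (hb : ∀ i, b i ≠ 0) {N : ℕ}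
    (hN : IsGreatest {n | quotPiece w (Ideal.span (Set.range f)) n ≠ ⊥} N) :
    N + ∑ i, w i = ∑ i, b i := by
  set J := Ideal.span (Set.range f)
  let P : Polynomial ℤ := ∑ n ∈ Finset.range (N + 1), Polynomial.monomial n (hilb w J n : ℤ)
  have hcoeff : ∀ n, P.coeff n = hilb w J n := by
    intro n
    simp only [P, Polynomial.finsetSum_coeff, Polynomial.coeff_monomial, Finset.sum_ite_eq',
      Finset.mem_range]
    split_ifs with h
    · rfl
    · have : quotPiece w J n = ⊥ := by
        by_contra h0
        have := hN.2 h0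
        omega
      rw [hilb, this, finrank_bot, Nat.cast_zero]
  have hP : (P : PowerSeries ℤ) = hilbSeries w J := by
    ext n
    rw [Polynomial.coeff_coe, hcoeff, hilbSeries, PowerSeries.coeff_mk]
  have hdeg : P.natDegree = N := by
    refine Polynomial.natDegree_eq_of_le_of_coeff_ne_zero ?_ ?_
    · rw [Polynomial.natDegree_le_iff_coeff_eq_zero]
      intro n hn
      rw [hcoeff]
      have : quotPiece w J n = ⊥ := by
        by_contra h0
        have := hN.2 h0
        omega
      rw [hilb, this, finrank_bot, Nat.cast_zero]
    · rw [hcoeff]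
      have := finiteDimensional_quotPiece hw J N
      exact_mod_cast fun h => hN.1 (Submodule.finrank_eq_zero.1 h)
  have hP0 : P ≠ 0 := by
    rintro h
    have h1 := hcoeff N
    rw [h, Polynomial.coeff_zero] at h1
    have := finiteDimensional_quotPiece hw J N
    exact hN.1 (Submodule.finrank_eq_zero.1 (by exact_mod_cast h1.symm))
  have h := geomPoly_mul_hilbSeries hw hf hreg
  change _ * hilbSeries w J = _ at h
  rw [← hP, ← Polynomial.coe_mul, Polynomial.coe_inj] at h
  have h2 := congrArg Polynomial.natDegree h
  rw [Polynomial.natDegree_mul (Finset.prod_ne_zero_iff.2 fun i _ => geomPoly_ne_zero (hw i)) hP0,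
    Polynomial.natDegree_prod _ _ (fun i _ => geomPoly_ne_zero (hw i)),
    Polynomial.natDegree_prod _ _ (fun i _ => geomPoly_ne_zero (hb i)), hdeg] at h2
  have e : ∀ a : Fin k → ℕ, (∀ i, a i ≠ 0) → ∑ i, a i = ∑ i, (geomPoly (a i)).natDegree + k := by
    intro a ha
    rw [← Finset.sum_congr rfl fun i _ => natDegree_geomPoly (ha i), Finset.sum_add_distrib]
    simp
  rw [e w hw, e b hb]
  omega

end Hilbert

/-! ### Relations that survive on coordinate subspaces -/

section Restr

variable {k : ℕ}

/-- Setting the variables outside `s` to zero. -/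
noncomputable def restr (s : Finset (Fin k)) : MvPolynomial (Fin k) ℚ →ₐ[ℚ] MvPolynomial (Fin k) ℚ :=
  aeval fun i => if i ∈ s then X i else 0

theorem sub_restr_mem (s : Finset (Fin k)) (p : MvPolynomial (Fin k) ℚ) :
    p - restr s p ∈ Ideal.span (X '' {i | i ∉ s} : Set (MvPolynomial (Fin k) ℚ)) := by
  induction p using MvPolynomial.induction_on with
  | C a => simp [restr, algHom_C, algebraMap_eq]
  | add p q hp hq =>
    rw [map_add, add_sub_add_comm]
    exact add_mem hp hq
  | mul_X p i hp =>
    rw [map_mul]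
    have hX : restr s (X i) = if i ∈ s then X i else 0 := by simp [restr]
    rw [hX]
    split_ifs with hi
    · rw [← sub_mul]
      exact Ideal.mul_mem_right _ _ hp
    · rw [mul_zero, sub_zero]
      exact Ideal.mul_mem_left _ _ (Ideal.subset_span ⟨i, hi, rfl⟩)

theorem ker_restr (s : Finset (Fin k)) :
    RingHom.ker (restr s) = Ideal.span (X '' {i | i ∉ s} : Set (MvPolynomial (Fin k) ℚ)) := by
  apply le_antisymm
  · intro p hp
    have := sub_restr_mem s p
    rwa [RingHom.mem_ker.1 hp, sub_zero] at this
  · rw [Ideal.span_le]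
    rintro _ ⟨i, hi, rfl⟩
    have hi' : i ∉ s := hi
    simp [restr, hi']

/-- Primality is clear from the description as the kernel of an endomorphism of a domain. -/
instance (s : Finset (Fin k)) :
    (Ideal.span (X '' {i | i ∉ s} : Set (MvPolynomial (Fin k) ℚ))).IsPrime :=
  ker_restr s ▸ RingHom.ker_isPrime _

/-- Adding the variables one at a time gives a strictly increasing chain of primes. -/
theorem card_le_height_span_X (s : Finset (Fin k)) :
    (sᶜ.card : ℕ∞) ≤ (Ideal.span (X '' {i | i ∉ s} : Set (MvPolynomial (Fin k) ℚ))).height := by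
  obtain ⟨t, rfl⟩ : ∃ t, s = tᶜ := ⟨sᶜ, by simp⟩
  rw [compl_compl]
  induction t using Finset.induction with
  | empty => simp
  | insert a t ha ih =>
    rw [Finset.card_insert_of_notMem ha, Nat.cast_add, Nat.cast_one]
    refine (add_le_add_left ih 1).trans (Ideal.height_add_one_le_of_lt_of_isPrime ?_)
    refine lt_of_le_of_ne (Ideal.span_mono (Set.image_mono fun i hi => ?_)) fun h => ?_
    · have : i ∈ t := by simpa using hi
      simp [this]
    · have : (X a : MvPolynomial (Fin k) ℚ) ∈ Ideal.span (X '' {i | i ∉ tᶜ}) := by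
        rw [h]; exact Ideal.subset_span ⟨a, by simp, rfl⟩
      rw [mem_ideal_span_X_image] at this
      obtain ⟨i, hi, h1⟩ := this (Finsupp.single a 1) (by simp [support_X])
      have hia : i ≠ a := by
        rintro rfl
        simp at hi
        exact ha hi
      simp [hia.symm] at h1

/-- If the quotient by homogeneous elements is finite-dimensional, then for every set `s` of
variables at least `#s` of them do not vanish after setting the other variables to zero. -/
theorem exists_relations_of_variables {m : ℕ} {u : Fin m → MvPolynomial (Fin k) ℚ}
    (hu : ∀ j, constantCoeff (u j) = 0)
    (hnil : ∀ i, ∃ n, (X i : MvPolynomial (Fin k) ℚ) ^ n ∈ Ideal.span (Set.range u))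
    (s : Finset (Fin k)) :
    ∃ t : Finset (Fin m), s.card ≤ t.card ∧
      ∀ j ∈ t, ∃ d ∈ (u j).support, ∀ i ∉ s, d i = 0 := by
  classical
  set P := Ideal.span (X '' {i | i ∉ s} : Set (MvPolynomial (Fin k) ℚ)) with hP
  set t : Finset (Fin m) := Finset.univ.filter fun j => u j ∉ P with ht
  refine ⟨t, ?_, fun j hj => ?_⟩
  · set M := Ideal.span (X '' {i | i ∉ (∅ : Finset (Fin k))} : Set (MvPolynomial (Fin k) ℚ))
    have hPM : P ≤ M := Ideal.span_mono (Set.image_mono fun i _ => by simp)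
    have huM : ∀ j, u j ∈ M := by
      intro j
      rw [mem_ideal_span_X_image]
      intro d hd
      by_contra! h
      obtain rfl : d = 0 := Finsupp.ext fun i => h i (by simp)
      exact mem_support_iff.1 hd (hu j)
    -- Relations in P are already accounted for by the variables outside s. So a prime containing G
    -- contains all relations, hence all variables by nilpotence, and M is minimal over G. Krull's
    -- height theorem then gives k ≤ #sᶜ + #t.
    set G : Set (MvPolynomial (Fin k) ℚ) := ↑(sᶜ.image X ∪ t.image u : Finset _) with hG
    have hmin : M ∈ (Ideal.span G).minimalPrimes := by
      refine ⟨⟨inferInstance, ?_⟩, ?_⟩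
      · rw [Ideal.span_le, hG]
        intro p hp
        simp only [Finset.coe_union, Finset.coe_image, Set.mem_union, Set.mem_image] at hp
        rcases hp with ⟨i, _, rfl⟩ | ⟨j, _, rfl⟩
        · exact Ideal.subset_span ⟨i, by simp, rfl⟩
        · exact huM j
      · rintro q ⟨hq, hGq⟩ _
        have hPq : P ≤ q := by
          refine le_trans (Ideal.span_le.2 ?_) hGq
          rintro _ ⟨i, hi, rfl⟩
          refine Ideal.subset_span ?_
          rw [hG, Finset.mem_coe, Finset.mem_union, Finset.mem_image]
          exact Or.inl ⟨i, by simpa using hi, rfl⟩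
        have huq : ∀ j, u j ∈ q := by
          intro j
          by_cases hj : u j ∈ P
          · exact hPq hj
          · refine hGq (Ideal.subset_span ?_)
            rw [hG, Finset.mem_coe, Finset.mem_union, Finset.mem_image, Finset.mem_image]
            exact Or.inr ⟨j, by simp [ht, hj], rfl⟩
        have hIq : Ideal.span (Set.range u) ≤ q := by
          rw [Ideal.span_le]
          rintro _ ⟨j, rfl⟩
          exact huq j
        rw [Ideal.span_le]
        rintro _ ⟨i, _, rfl⟩
        obtain ⟨n, hn⟩ := hnil i
        exact hq.mem_of_pow_mem n (hIq hn)
    have h1 := Ideal.height_le_card_of_mem_minimalPrimes_span_finset hmin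
    have h2 := card_le_height_span_X (∅ : Finset (Fin k))
    have h3 : ((∅ : Finset (Fin k))ᶜ.card : ℕ∞) ≤ _ := h2.trans h1
    rw [Nat.cast_le] at h3
    have h4 := (h3.trans (Finset.card_union_le _ _)).trans
      (add_le_add Finset.card_image_le Finset.card_image_le)
    have h5 := Finset.card_add_card_compl s
    simp only [Finset.compl_empty, Finset.card_univ, Fintype.card_fin] at h4 h5
    omega
  · have hjP : u j ∉ P := by simpa [ht] using hj
    rw [hP, mem_ideal_span_X_image] at hjP
    push Not at hjP
    exact hjP

end Restr

/-! ### First consequences for pure models -/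

namespace PositivelyElliptic

variable {k : ℕ} (H : PositivelyElliptic k)

/-- The ideal of relations. -/
noncomputable abbrev relIdeal : Ideal (MvPolynomial (Fin k) ℚ) := Ideal.span (Set.range H.rel)

theorem deg_ne_zero (i : Fin k) : H.deg i ≠ 0 := (H.deg_pos i).ne'

theorem regularFamily : RegularFamily H.rel := (isWeaklyRegular_ofFn_iff _).1 H.rel_regular

theorem mem_piece {n : ℕ} {x : H.Alg} :
    x ∈ H.piece n ↔ ∃ p, IsWeightedHomogeneous H.deg p n ∧ Ideal.Quotient.mk H.relIdeal p = x :=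
  mem_quotPiece

theorem exists_bound : ∃ B, ∀ n, B < n → ∀ p, IsWeightedHomogeneous H.deg p n → p ∈ H.relIdeal := by
  obtain ⟨B, hB⟩ := exists_quotPiece_eq_bot H.deg_ne_zero H.rel_homogeneous H.regularFamily
  refine ⟨B, fun n hn p hp => ?_⟩
  have : Ideal.Quotient.mk H.relIdeal p ∈ quotPiece H.deg H.relIdeal n := mem_quotPiece.2 ⟨p, hp, rfl⟩
  rw [hB n hn] at this
  exact Ideal.Quotient.eq_zero_iff_mem.1 this

theorem exists_X_pow_mem (i : Fin k) : ∃ n, (X i : MvPolynomial (Fin k) ℚ) ^ n ∈ H.relIdeal := by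
  obtain ⟨B, hB⟩ := H.exists_bound
  refine ⟨B + 1, hB ((B + 1) * H.deg i) ?_ _ ?_⟩
  · have := H.deg_pos i
    nlinarith
  · exact (isWeightedHomogeneous_X ℚ H.deg i).pow (B + 1)

theorem weight_eq_sum (w : Fin k → ℕ) (d : Fin k →₀ ℕ) : Finsupp.weight w d = ∑ i, d i * w i := by
  rw [Finsupp.weight_apply, Finsupp.sum_fintype _ _ (by simp)]
  simp

variable {H}

theorem IsPureModel.constantCoeff_rel (h : H.IsPureModel) (i : Fin k) :
    constantCoeff (H.rel i) = 0 := by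
  by_contra h0
  have := h.two_le i 0 (mem_support_iff.2 h0)
  simp at this

theorem constantCoeff_of_mem (h : ∀ i, constantCoeff (H.rel i) = 0) {p : MvPolynomial (Fin k) ℚ}
    (hp : p ∈ H.relIdeal) : constantCoeff p = 0 := by
  have : H.relIdeal ≤ RingHom.ker (constantCoeff (σ := Fin k) (R := ℚ)) := by
    rw [Ideal.span_le]
    rintro _ ⟨i, rfl⟩
    exact h i
  exact this hp

theorem rel_ne_zero (h : ∀ i, constantCoeff (H.rel i) = 0) (i : Fin k) : H.rel i ≠ 0 := by
  intro h0
  have h1 := H.regularFamily i 1 (by rw [h0, zero_mul]; exact zero_mem _)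
  have h2 := constantCoeff_of_mem h (Ideal.span_mono (Set.image_subset_range _ _) h1)
  simp at h2

theorem relDeg_eq_sum {i : Fin k} {d : Fin k →₀ ℕ} (hd : d ∈ (H.rel i).support) :
    H.relDeg i = ∑ j, d j * H.deg j := by
  rw [← weight_eq_sum]
  exact (H.rel_homogeneous i (mem_support_iff.1 hd)).symm

theorem relDeg_even (h : ∀ i, constantCoeff (H.rel i) = 0) (i : Fin k) : Even (H.relDeg i) := by
  obtain ⟨d, hd⟩ := support_nonempty.2 (rel_ne_zero h i)
  rw [relDeg_eq_sum hd]
  exact Finset.even_sum _ fun j _ => (H.deg_even j).mul_left _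

theorem IsPureModel.relDeg_pos (h : H.IsPureModel) (i : Fin k) : 0 < H.relDeg i := by
  obtain ⟨d, hd⟩ := support_nonempty.2 (rel_ne_zero h.constantCoeff_rel i)
  rw [relDeg_eq_sum hd]
  by_contra! h0
  have h1 : ∀ j, d j = 0 := by
    intro j
    have := (Finset.sum_eq_zero_iff.1 (Nat.le_zero.1 h0)) j (Finset.mem_univ _)
    exact (mul_eq_zero.1 this).resolve_right (H.deg_ne_zero j)
  have := h.two_le i d hd
  rw [show d = 0 from Finsupp.ext h1] at this
  simp at this

theorem IsPureModel.formalDimension (h : H.IsPureModel) {N : ℕ} (hN : H.IsFormalDimension N) :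
    N + ∑ i, H.deg i = ∑ i, H.relDeg i :=
  formalDimension_add_sum H.deg_ne_zero H.rel_homogeneous H.regularFamily
    (fun i => (h.relDeg_pos i).ne') hN

theorem IsPureModel.exists_relations (h : H.IsPureModel) (s : Finset (Fin k)) :
    ∃ t : Finset (Fin k), s.card ≤ t.card ∧
      ∀ j ∈ t, ∃ d ∈ (H.rel j).support, 2 ≤ d.degree ∧ ∀ i ∉ s, d i = 0 := by
  obtain ⟨t, ht, hj⟩ := exists_relations_of_variables h.constantCoeff_rel H.exists_X_pow_mem s
  refine ⟨t, ht, fun j hjt => ?_⟩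
  obtain ⟨d, hd, hds⟩ := hj j hjt
  exact ⟨d, hd, h.two_le j d hd, hds⟩

/-- Each relation satisfies `|u_i| ≥ 2 |x_i|`. -/
theorem IsPureModel.two_mul_deg_le (h : H.IsPureModel) (i : Fin k) :
    2 * H.deg i ≤ H.relDeg i := by
  -- The k - i variables from x_i on need k - i relations, whereas only k - i - 1 indices exceed i.
  -- So some u_j with j ≤ i contains a monomial of length at least 2 in variables of degree at least
  -- |x_i|.
  obtain ⟨t, ht, htj⟩ := h.exists_relations (Finset.Ici i)
  obtain ⟨j, hjt, hji⟩ : ∃ j ∈ t, j ≤ i := by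
    by_contra! hlt
    have := Finset.card_le_card (s := t) (t := Finset.Ioi i) fun j hj => by simpa using hlt j hj
    rw [Fin.card_Ioi] at this
    rw [Fin.card_Ici] at ht
    have := i.2
    omega
  obtain ⟨d, hd, h2, hds⟩ := htj j hjt
  refine le_trans ?_ (h.relDeg_mono hji)
  rw [relDeg_eq_sum hd]
  calc 2 * H.deg i ≤ d.degree * H.deg i := Nat.mul_le_mul_right _ h2
    _ = ∑ l, d l * H.deg i := by rw [Finsupp.degree_eq_sum, Finset.sum_mul]
    _ ≤ ∑ l, d l * H.deg l := Finset.sum_le_sum fun l _ => by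
        by_cases hl : i ≤ l
        · exact Nat.mul_le_mul_left _ (h.deg_mono hl)
        · rw [hds l (by simpa using hl), zero_mul, zero_mul]

end PositivelyElliptic

/-! ### Regular sequences over a base with nilpotent maximal ideal -/

section NilpotentBase

variable {K : Type*} [CommRing K] {m : Ideal K}

/-- For the least n with m^n r = 0, some element of m^{n-1} does not kill r; the product lies in the
socle. -/
theorem exists_ne_zero_mul_eq_zero (hnil : IsNilpotent m) {r : K} (hr : r ≠ 0) :
    ∃ t, t * r ≠ 0 ∧ ∀ y ∈ m, y * (t * r) = 0 := by
  classical
  obtain ⟨n, hn⟩ := hnil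
  have hex : ∃ n, ∀ t ∈ m ^ n, t * r = 0 := ⟨n, fun t ht => by
    rw [hn] at ht
    rw [show t = 0 from ht, zero_mul]⟩
  have h0 : Nat.find hex ≠ 0 := by
    intro h
    have := Nat.find_spec hex 1 (by rw [h, pow_zero, Ideal.one_eq_top]; trivial)
    exact hr (by rwa [one_mul] at this)
  have h1 := Nat.find_min hex (Nat.pred_lt h0)
  push Not at h1
  rw [Nat.pred_eq_sub_one] at h1
  obtain ⟨t, ht, htr⟩ := h1
  refine ⟨t, htr, fun y hy => ?_⟩
  rw [← mul_assoc]
  refine Nat.find_spec hex _ ?_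
  have := Ideal.mul_mem_mul hy ht
  rwa [← pow_succ', Nat.sub_add_cancel (Nat.pos_of_ne_zero h0)] at this

theorem mem_of_mul_eq_zero [hm : m.IsMaximal] (hnil : IsNilpotent m) {s x : K} (hs : s ≠ 0)
    (hx : s * x = 0) : x ∈ m := by
  by_contra hxm
  obtain ⟨y, hy⟩ := hm.exists_inv hxm
  obtain ⟨z, hz, hyz⟩ := hy
  have hznil : IsNilpotent z := by
    obtain ⟨n, hn⟩ := hnil
    refine ⟨n, ?_⟩
    have := Ideal.pow_mem_pow hz n
    rwa [hn] at this
  have hu : IsUnit (y * x) := by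
    rw [eq_sub_of_add_eq hyz]
    exact hznil.isUnit_one_sub
  have : s * (y * x) = 0 := by rw [mul_left_comm, hx, mul_zero]
  exact hs ((hu.mul_left_eq_zero).1 this)

variable {A : Type*} [AddCommGroup A] [Module K A]

/-- Embed the projective module in a free one: each coordinate of x is killed by s ≠ 0, so it is not
a unit and lies in m. -/
theorem mem_smul_top_of_smul_eq_zero [m.IsMaximal] (hnil : IsNilpotent m) [Module.Projective K A]
    {s : K} (hs : s ≠ 0) {x : A} (hx : s • x = 0) : x ∈ m • (⊤ : Submodule K A) := by
  obtain ⟨i, hi⟩ := Module.projective_def'.1 ‹Module.Projective K A›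
  have h1 : ∀ a, i x a ∈ m := fun a => by
    refine mem_of_mul_eq_zero hnil hs ?_
    have := congrArg (fun y => i y a) hx
    simpa using this
  have h2 : Finsupp.linearCombination K id (i x) = x := LinearMap.congr_fun hi x
  rw [← h2, Finsupp.linearCombination_apply]
  exact Submodule.sum_mem _ fun a _ => Submodule.smul_mem_smul (h1 a) Submodule.mem_top

/-- This is injectivity of φ modulo m. A non-zero socle element t kills φ x ∈ mA, hence kills x by
injectivity, and then the coordinates of x lie in m. -/
theorem mem_smul_top_of_injective [hm : m.IsMaximal] (hnil : IsNilpotent m) [Module.Projective K A]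
    {φ : A →ₗ[K] A} (hφ : Function.Injective φ) {x : A}
    (hx : φ x ∈ m • (⊤ : Submodule K A)) : x ∈ m • (⊤ : Submodule K A) := by
  have : Nontrivial K := by
    by_contra h
    rw [not_nontrivial_iff_subsingleton] at h
    exact hm.ne_top (Subsingleton.elim _ _)
  obtain ⟨t, ht, hmt⟩ := exists_ne_zero_mul_eq_zero hnil (one_ne_zero (α := K))
  refine mem_smul_top_of_smul_eq_zero hnil ht (hφ ?_)
  rw [map_zero, map_smul]
  generalize φ x = z at hx
  induction hx using Submodule.smul_induction_on' with
  | smul r hr y _ => rw [smul_smul, mul_comm, hmt r hr, zero_smul]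
  | add y _ z _ hy hz => rw [smul_add, hy, hz, add_zero]

/-- Modulo m the map is an injection of vector spaces and has a left inverse. Projectivity lifts it
to r with r ∘ φ congruent to the identity modulo m. As m is nilpotent, r ∘ φ is invertible, so φ
splits and its cokernel is a direct summand of A. -/
theorem projective_quotient_range [hm : m.IsMaximal] (hnil : IsNilpotent m)
    [Module.Projective K A] {φ : A →ₗ[K] A} (hφ : Function.Injective φ) :
    Module.Projective K (A ⧸ LinearMap.range φ) := by
  let mA : Submodule K A := m • ⊤
  let : Field (K ⧸ m) := Ideal.Quotient.field m
  have hle : mA ≤ mA.comap φ := by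
    rw [← Submodule.map_le_iff_le_comap, Submodule.map_smul'']
    exact smul_mono_right _ le_top
  let φ' : (A ⧸ mA) →ₗ[K] (A ⧸ mA) := mA.mapQ mA φ hle
  have hφ' : Function.Injective φ' := by
    rw [injective_iff_map_eq_zero]
    intro x
    obtain ⟨x, rfl⟩ := Submodule.mkQ_surjective _ x
    intro hx
    have hx' : φ x ∈ mA := (Submodule.Quotient.mk_eq_zero _).1 hx
    exact (Submodule.Quotient.mk_eq_zero _).2 (mem_smul_top_of_injective hnil hφ hx')
  let φk : (A ⧸ mA) →ₗ[K ⧸ m] (A ⧸ mA) :=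
    φ'.extendScalarsOfSurjective Ideal.Quotient.mk_surjective
  obtain ⟨ρ, hρ⟩ := φk.exists_leftInverse_of_injective (LinearMap.ker_eq_bot.2 hφ')
  obtain ⟨r, hr⟩ := Module.projective_lifting_property mA.mkQ
    ((ρ.restrictScalars K) ∘ₗ mA.mkQ) (Submodule.mkQ_surjective _)
  have hr1 : ∀ a, r (φ a) - a ∈ mA := by
    intro a
    rw [← Submodule.Quotient.mk_eq_zero, Submodule.Quotient.mk_sub, sub_eq_zero]
    have e1 : mA.mkQ (r (φ a)) = ρ (mA.mkQ (φ a)) := LinearMap.congr_fun hr (φ a)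
    have e2 : ρ (φk (mA.mkQ a)) = mA.mkQ a := LinearMap.congr_fun hρ (mA.mkQ a)
    exact e1.trans e2
  let ν : Module.End K A := LinearMap.id - r ∘ₗ φ
  have hν : ∀ (j : ℕ) (a : A), a ∈ m ^ j • (⊤ : Submodule K A) →
      ν a ∈ m ^ (j + 1) • (⊤ : Submodule K A) := by
    intro j a ha
    induction ha using Submodule.smul_induction_on' with
    | smul x hx y _ =>
      rw [map_smul, pow_succ, mul_smul]
      refine Submodule.smul_mem_smul hx ?_
      have := neg_mem (hr1 y)
      rwa [neg_sub] at this
    | add y _ z _ hy hz => rw [map_add]; exact add_mem hy hz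
  have hνpow : ∀ (j : ℕ) (a : A), (ν ^ j) a ∈ m ^ j • (⊤ : Submodule K A) := by
    intro j
    induction j with
    | zero => intro a; simp
    | succ j ih =>
      intro a
      rw [pow_succ' ν]
      exact hν j _ (ih a)
  have hνnil : IsNilpotent ν := by
    obtain ⟨n, hn⟩ := hnil
    refine ⟨n, LinearMap.ext fun a => ?_⟩
    have := hνpow n a
    rw [hn] at this
    simpa using this
  obtain ⟨θ, hθ⟩ := (hνnil.isUnit_one_sub).exists_left_inv
  have hθ' : ∀ a, θ (r (φ a)) = a := by
    intro a
    have := LinearMap.congr_fun hθ a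
    have e : (1 - ν) a = r (φ a) := by simp [ν]
    rw [Module.End.mul_apply, e] at this
    simpa using this
  -- The projection along the image of φ; it descends to a section of the quotient map.
  let ψ : A →ₗ[K] A := LinearMap.id - φ ∘ₗ θ ∘ₗ r
  have hψ : LinearMap.range φ ≤ LinearMap.ker ψ := by
    rintro _ ⟨a, rfl⟩
    rw [LinearMap.mem_ker]
    simp [ψ, hθ']
  refine Module.Projective.of_split ((LinearMap.range φ).liftQ ψ hψ) (LinearMap.range φ).mkQ ?_
  refine Submodule.linearMap_qext _ (LinearMap.ext fun a => ?_)
  show Submodule.Quotient.mk (ψ a) = Submodule.Quotient.mk a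
  rw [Submodule.Quotient.eq]
  exact ⟨-(θ (r a)), by simp [ψ]⟩

variable {F : Type*} [CommRing F] [Algebra K F]

theorem map_smul_top_quotient (J : Ideal F) (x : F) :
    Ideal.Quotient.mk J x ∈ (m • ⊤ : Submodule K (F ⧸ J)) ↔ x ∈ J ⊔ m.map (algebraMap K F) := by
  have h1 : (m • ⊤ : Submodule K (F ⧸ J)) =
      ((m.map (algebraMap K F)).map (Ideal.Quotient.mk J)).restrictScalars K := by
    rw [Ideal.map_map, Ideal.smul_top_eq_map]
    rfl
  rw [h1, Submodule.restrictScalars_mem, Ideal.mem_map_iff_of_surjective _ Ideal.Quotient.mk_surjective]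
  constructor
  · rintro ⟨y, hy, hxy⟩
    rw [Submodule.mem_sup']
    refine ⟨⟨x - y, ?_⟩, ⟨y, hy⟩, by simp⟩
    rw [← Ideal.Quotient.eq, hxy]
  · intro hx
    obtain ⟨j, hj, y, hy, rfl⟩ := Submodule.mem_sup.1 hx
    refine ⟨y, hy, ?_⟩
    rw [map_add, Ideal.Quotient.eq_zero_iff_mem.2 hj, zero_add]

theorem projective_quotient_span_insert [hm : m.IsMaximal] (hnil : IsNilpotent m) (J : Ideal F)
    [Module.Projective K (F ⧸ J)] (a : F) (ha : ∀ p, a * p ∈ J → p ∈ J) :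
    Module.Projective K (F ⧸ (Ideal.span {a} ⊔ J)) ∧
      ∀ p, a * p ∈ J ⊔ m.map (algebraMap K F) → p ∈ J ⊔ m.map (algebraMap K F) := by
  let φ : (F ⧸ J) →ₗ[K] (F ⧸ J) := LinearMap.mulLeft K (Ideal.Quotient.mk J a)
  have hφm : ∀ p, φ (Ideal.Quotient.mk J p) = Ideal.Quotient.mk J (a * p) := fun p =>
    (map_mul _ _ _).symm
  have hφ : Function.Injective φ := by
    rw [injective_iff_map_eq_zero]
    intro x
    obtain ⟨p, rfl⟩ := Ideal.Quotient.mk_surjective x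
    rw [hφm]
    intro h
    exact Ideal.Quotient.eq_zero_iff_mem.2 (ha p (Ideal.Quotient.eq_zero_iff_mem.1 h))
  constructor
  · have := projective_quotient_range hnil hφ
    have hle : J ≤ Ideal.span {a} ⊔ J := le_sup_right
    let g : (F ⧸ J) →ₗ[K] (F ⧸ (Ideal.span {a} ⊔ J)) := (Ideal.Quotient.factorₐ K hle).toLinearMap
    have hg : Function.Surjective g := Ideal.Quotient.factor_surjective hle
    have hker : LinearMap.ker g = LinearMap.range φ := by
      ext x
      obtain ⟨p, rfl⟩ := Ideal.Quotient.mk_surjective x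
      rw [LinearMap.mem_ker]
      have e : g (Ideal.Quotient.mk J p) = Ideal.Quotient.mk _ p := rfl
      rw [e, Ideal.Quotient.eq_zero_iff_mem]
      constructor
      · intro h
        obtain ⟨y, hy, j, hj, rfl⟩ := Submodule.mem_sup.1 h
        obtain ⟨c, rfl⟩ := Ideal.mem_span_singleton'.1 hy
        refine ⟨Ideal.Quotient.mk J c, ?_⟩
        rw [hφm, map_add, Ideal.Quotient.eq_zero_iff_mem.2 hj, add_zero, mul_comm]
      · rintro ⟨y, hy⟩
        obtain ⟨c, rfl⟩ := Ideal.Quotient.mk_surjective y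
        rw [hφm, eq_comm, Ideal.Quotient.eq] at hy
        have h2 : a * c ∈ Ideal.span {a} ⊔ J :=
          Ideal.mem_sup_left (Ideal.mul_mem_right _ _ (Ideal.mem_span_singleton_self a))
        have := add_mem (Ideal.mem_sup_right (S := Ideal.span {a}) hy) h2
        rwa [sub_add_cancel] at this
    refine Module.Projective.of_equiv
      ((Submodule.quotEquivOfEq _ _ hker.symm).trans (g.quotKerEquivOfSurjective hg))
  · intro p hp
    rw [← map_smul_top_quotient] at hp ⊢
    rw [← hφm] at hp
    exact mem_smul_top_of_injective hnil hφ hp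

/-- Induction on the length: each quotient is the cokernel of an injective endomorphism of the
previous projective module, and that endomorphism stays injective modulo m. The second conclusion is
regularity over the residue field, written without leaving F. -/
theorem projective_quotient_regularFamily [hm : m.IsMaximal] (hnil : IsNilpotent m)
    [Module.Projective K F] {n : ℕ} {w : Fin n → F} (hw : RegularFamily w) :
    Module.Projective K (F ⧸ Ideal.span (Set.range w)) ∧
      ∀ i p, w i * p ∈ Ideal.span (w '' Set.Iio i) ⊔ m.map (algebraMap K F) →
        p ∈ Ideal.span (w '' Set.Iio i) ⊔ m.map (algebraMap K F) := by
  have e3 : ∀ (j : ℕ) (hj : j < n), Set.Iio (⟨j, hj⟩ : Fin n) = {i : Fin n | (i : ℕ) < j} := by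
    intro j hj
    ext i; simp [Fin.lt_def]
  have key : ∀ j ≤ n, Module.Projective K (F ⧸ Ideal.span (w '' {i : Fin n | (i : ℕ) < j})) := by
    intro j
    induction j with
    | zero =>
      intro _
      have e : Ideal.span (w '' {i : Fin n | (i : ℕ) < 0}) = ⊥ := by simp
      rw [e]
      exact Module.Projective.of_equiv
        (Submodule.quotEquivOfEqBot ((⊥ : Ideal F).restrictScalars K) rfl).symm
    | succ j ih =>
      intro hj
      have e1 : {i : Fin n | (i : ℕ) < j + 1} =
          insert (⟨j, hj⟩ : Fin n) {i : Fin n | (i : ℕ) < j} := by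
        ext i; simp [Fin.ext_iff]; omega
      rw [e1, Set.image_insert_eq, Ideal.span_insert]
      have := ih (by omega)
      refine (projective_quotient_span_insert hnil _ _ ?_).1
      have h2 := hw ⟨j, hj⟩
      rwa [e3] at h2
  constructor
  · have := key n le_rfl
    have e : {i : Fin n | (i : ℕ) < n} = Set.univ := by ext i; simp
    rwa [e, Set.image_univ] at this
  · rintro ⟨j, hj⟩
    have h1 := hw ⟨j, hj⟩
    have h2 := key j hj.le
    rw [e3] at h1 ⊢
    exact (projective_quotient_span_insert hnil _ _ h1).2

/-- If r ≠ 0 killed 1, projectivity would give 1 ∈ mB, against the existence of a unital map χ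
killing mB. -/
theorem eq_zero_of_algebraMap_eq_zero [hm : m.IsMaximal] (hnil : IsNilpotent m)
    {B : Type*} [CommRing B] [Algebra K B] [Module.Projective K B]
    {L : Type*} [Semiring L] [Nontrivial L] (χ : B →+* L) (hχ : ∀ r ∈ m, χ (algebraMap K B r) = 0)
    {r : K} (hr : algebraMap K B r = 0) : r = 0 := by
  by_contra h0
  have : r • (1 : B) = 0 := by rw [← Algebra.algebraMap_eq_smul_one, hr]
  have h1 := mem_smul_top_of_smul_eq_zero hnil h0 this
  rw [Ideal.smul_top_eq_map, Submodule.restrictScalars_mem] at h1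
  have h2 : m.map (algebraMap K B) ≤ RingHom.ker χ := Ideal.map_le_iff_le_comap.2 hχ
  exact one_ne_zero ((map_one χ).symm.trans (h2 h1))

theorem eq_zero_of_algebraMap_mem_span_regularFamily [hm : m.IsMaximal] (hnil : IsNilpotent m)
    [Module.Projective K F] {n : ℕ} {w : Fin n → F} (hw : RegularFamily w)
    {L : Type*} [Semiring L] [Nontrivial L] (χ : F →+* L) (hχm : ∀ r ∈ m, χ (algebraMap K F r) = 0)
    (hχw : ∀ i, χ (w i) = 0) {r : K} (hr : algebraMap K F r ∈ Ideal.span (Set.range w)) : r = 0 := by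
  have := (projective_quotient_regularFamily hnil hw).1
  have hle : ∀ x ∈ Ideal.span (Set.range w), χ x = 0 := by
    have : Ideal.span (Set.range w) ≤ RingHom.ker χ := by
      rw [Ideal.span_le]
      rintro _ ⟨i, rfl⟩
      exact hχw i
    exact fun x hx => this hx
  exact eq_zero_of_algebraMap_eq_zero hnil (B := F ⧸ Ideal.span (Set.range w))
    (Ideal.Quotient.lift _ χ hle) hχm (Ideal.Quotient.eq_zero_iff_mem.2 hr)

end NilpotentBase

/-! ### Splitting off the subalgebra generated by the first variables -/

theorem mem_span_image_iff_of_surjective {A B ι : Type*} [CommRing A] [CommRing B] [Algebra ℚ A]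
    [Algebra ℚ B] (θ : A →ₐ[ℚ] B)
    (hθ : Function.Surjective θ) (u : ι → A) (s : Set ι) (x : A) :
    θ x ∈ Ideal.span ((fun i => θ (u i)) '' s) ↔ x ∈ Ideal.span (u '' s) ⊔ RingHom.ker θ := by
  have h1 : Ideal.span ((fun i => θ (u i)) '' s) = (Ideal.span (u '' s)).map θ := by
    rw [Ideal.map_span, Set.image_image]
  rw [h1, ← Ideal.mem_comap, Ideal.comap_map_of_surjective θ hθ]
  rfl

theorem isWeightedHomogeneous_aeval {σ τ : Type*} {w : σ → ℕ} {w' : τ → ℕ}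
    {f : σ → MvPolynomial τ ℚ} (hf : ∀ i, IsWeightedHomogeneous w' (f i) (w i))
    {p : MvPolynomial σ ℚ} {n : ℕ} (hp : IsWeightedHomogeneous w p n) :
    IsWeightedHomogeneous w' (aeval f p) n := by
  rw [p.as_sum, map_sum]
  refine IsWeightedHomogeneous.sum _ _ _ fun d hd => ?_
  rw [aeval_monomial, algebraMap_eq]
  refine IsWeightedHomogeneous.C_mul ?_ _
  rw [← hp (mem_support_iff.1 hd), Finsupp.weight_apply]
  refine IsWeightedHomogeneous.prod _ _ _ fun i _ => ?_
  exact (hf i).pow (d i)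

theorem aeval_mem_pow_idealOfVars {σ τ : Type*} {f : σ → MvPolynomial τ ℚ}
    (hf : ∀ i, f i ∈ idealOfVars τ ℚ) {p : MvPolynomial σ ℚ} {n : ℕ}
    (hp : p ∈ idealOfVars σ ℚ ^ n) : aeval f p ∈ idealOfVars τ ℚ ^ n := by
  have h1 : (idealOfVars σ ℚ).map (aeval f : MvPolynomial σ ℚ →ₐ[ℚ] MvPolynomial τ ℚ) ≤
      idealOfVars τ ℚ := by
    rw [Ideal.map_span, Ideal.span_le]
    rintro _ ⟨_, ⟨i, rfl⟩, rfl⟩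
    simpa using hf i
  have h2 := Ideal.mem_map_of_mem (aeval f : MvPolynomial σ ℚ →ₐ[ℚ] MvPolynomial τ ℚ) hp
  rw [Ideal.map_pow] at h2
  exact Ideal.pow_right_mono h1 n h2

theorem X_notMem_of_le_sq {σ : Type*} {J : Ideal (MvPolynomial σ ℚ)}
    (hJ : J ≤ idealOfVars σ ℚ ^ 2) (i : σ) : (X i : MvPolynomial σ ℚ) ∉ J := by
  intro h
  have := (mem_pow_idealOfVars_iff 2 _).1 (hJ h) (Finsupp.single i 1) (by simp [support_X])
  simp at this

theorem mem_idealOfVars_iff {k : ℕ} {p : MvPolynomial (Fin k) ℚ} :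
    p ∈ idealOfVars (Fin k) ℚ ↔ constantCoeff p = 0 := by
  rw [← pow_one (idealOfVars (Fin k) ℚ), mem_pow_idealOfVars_iff']
  constructor
  · intro h
    exact h 0 (by simp)
  · intro h d hd
    obtain rfl : d = 0 := by rwa [Nat.lt_one_iff, Finsupp.degree_eq_zero_iff] at hd
    exact h

namespace PositivelyElliptic

section Split

variable {l n : ℕ}

/-- The inclusion of the polynomials in the first `l` variables. -/
noncomputable def inclFst (l n : ℕ) : MvPolynomial (Fin l) ℚ →ₐ[ℚ] MvPolynomial (Fin (l + n)) ℚ :=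
  aeval fun i => X (Fin.castAdd n i)

/-- Setting the last `n` variables to zero. -/
noncomputable def projFst (l n : ℕ) : MvPolynomial (Fin (l + n)) ℚ →ₐ[ℚ] MvPolynomial (Fin l) ℚ :=
  aeval (Fin.addCases X fun _ => 0)

/-- Setting the first `l` variables to zero. -/
noncomputable def projSnd (l n : ℕ) : MvPolynomial (Fin (l + n)) ℚ →ₐ[ℚ] MvPolynomial (Fin n) ℚ :=
  aeval (Fin.addCases (fun _ => 0) X)

theorem projFst_inclFst (p : MvPolynomial (Fin l) ℚ) : projFst l n (inclFst l n p) = p := by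
  have : (projFst l n).comp (inclFst l n) = AlgHom.id ℚ _ := by
    ext i; simp [projFst, inclFst]
  exact AlgHom.congr_fun this p

theorem projSnd_surjective : Function.Surjective (projSnd l n) := by
  intro p
  refine ⟨aeval (fun j => X (Fin.natAdd l j)) p, ?_⟩
  have : (projSnd l n).comp (aeval fun j => X (Fin.natAdd l j)) = AlgHom.id ℚ _ := by
    ext i; simp [projSnd]
  exact AlgHom.congr_fun this p

theorem ker_projSnd_le : RingHom.ker (projSnd l n) ≤
    Ideal.span (Set.range fun i => (X (Fin.castAdd n i) : MvPolynomial (Fin (l + n)) ℚ)) := by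
  set J := Ideal.span (Set.range fun i => (X (Fin.castAdd n i) : MvPolynomial (Fin (l + n)) ℚ))
  have key : ∀ p, p - aeval (fun j => X (Fin.natAdd l j)) (projSnd l n p) ∈ J := by
    intro p
    induction p using MvPolynomial.induction_on with
    | C a => simp [projSnd, algHom_C, algebraMap_eq]
    | add p q hp hq =>
      rw [map_add, map_add, add_sub_add_comm]
      exact add_mem hp hq
    | mul_X p i hp =>
      rw [map_mul, map_mul]
      induction i using Fin.addCases with
      | left i =>
        have : projSnd l n (X (Fin.castAdd n i)) = 0 := by simp [projSnd]
        rw [this, map_zero, mul_zero, sub_zero]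
        exact Ideal.mul_mem_left _ _ (Ideal.subset_span ⟨i, rfl⟩)
      | right j =>
        have : projSnd l n (X (Fin.natAdd l j)) = X j := by simp [projSnd]
        rw [this, aeval_X, ← sub_mul]
        exact Ideal.mul_mem_right _ _ hp
  intro p hp
  have := key p
  rwa [RingHom.mem_ker.1 hp, map_zero, sub_zero] at this

variable (H : PositivelyElliptic (l + n)) (v : Fin l → MvPolynomial (Fin l) ℚ)

/-- The inclusion of the first variables has the retraction `projFst`. Both carry the ideals of
earlier relations into each other, so regularity is inherited from H. -/
theorem regularFamily_of_inclFst (hv : ∀ i, inclFst l n (v i) = H.rel (Fin.castAdd n i)) :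
    RegularFamily v := by
  have h1 : ∀ i : Fin l, ∀ p, p ∈ Ideal.span (v '' Set.Iio i) →
      inclFst l n p ∈ Ideal.span (H.rel '' Set.Iio (Fin.castAdd n i)) := by
    intro i p hp
    have := Ideal.mem_map_of_mem (inclFst l n) hp
    rw [Ideal.map_span] at this
    refine Ideal.span_mono ?_ this
    rintro _ ⟨_, ⟨j, hj, rfl⟩, rfl⟩
    exact ⟨Fin.castAdd n j, hj, (hv j).symm⟩
  have h2 : ∀ i : Fin l, ∀ p, p ∈ Ideal.span (H.rel '' Set.Iio (Fin.castAdd n i)) →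
      projFst l n p ∈ Ideal.span (v '' Set.Iio i) := by
    intro i p hp
    have := Ideal.mem_map_of_mem (projFst l n) hp
    rw [Ideal.map_span] at this
    refine Ideal.span_mono ?_ this
    rintro _ ⟨_, ⟨j, hj, rfl⟩, rfl⟩
    have hj' : (j : ℕ) < i := hj
    refine ⟨⟨j, hj'.trans i.2⟩, hj', ?_⟩
    rw [← projFst_inclFst (n := n) (v _), hv]
    rfl
  intro i p hp
  have h3 := h1 i _ hp
  rw [map_mul, hv] at h3
  have h4 := h2 i _ (H.regularFamily _ _ h3)
  rwa [projFst_inclFst] at h4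

/-- The subalgebra generated by the first generators, if the first relations only involve these. -/
noncomputable def subModel (hv : ∀ i, inclFst l n (v i) = H.rel (Fin.castAdd n i)) :
    PositivelyElliptic l where
  deg i := H.deg (Fin.castAdd n i)
  rel := v
  relDeg i := H.relDeg (Fin.castAdd n i)
  deg_pos _ := H.deg_pos _
  deg_even _ := H.deg_even _
  rel_homogeneous i := by
    have h := H.rel_homogeneous (Fin.castAdd n i)
    rw [← hv] at h
    rw [← projFst_inclFst (n := n) (v i)]
    refine isWeightedHomogeneous_aeval (fun j => ?_) h
    induction j using Fin.addCases with
    | left i => simpa using isWeightedHomogeneous_X ℚ _ i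
    | right j => simpa using isWeightedHomogeneous_zero ℚ _ _
  rel_regular := (isWeaklyRegular_ofFn_iff _).2 (regularFamily_of_inclFst H v hv)

/-- The extension of scalars of a polynomial ring in `n` variables to the quotient by `v`, as
an algebra over the polynomial ring in all variables. -/
noncomputable def toPolyQuot : MvPolynomial (Fin (l + n)) ℚ →ₐ[ℚ]
    MvPolynomial (Fin n) (MvPolynomial (Fin l) ℚ ⧸ Ideal.span (Set.range v)) :=
  aeval (Fin.addCases (fun i => C (Ideal.Quotient.mk _ (X i))) X)

theorem toPolyQuot_inclFst (p : MvPolynomial (Fin l) ℚ) :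
    toPolyQuot (n := n) v (inclFst l n p) = C (Ideal.Quotient.mk _ p) := by
  have : ((toPolyQuot (n := n) v).comp (inclFst l n)).toRingHom = C.comp (Ideal.Quotient.mk _) := by
    apply MvPolynomial.ringHom_ext'
    · exact RingHom.ext_rat _ _
    · intro i
      simp [toPolyQuot, inclFst]
  exact RingHom.congr_fun this p

theorem toPolyQuot_surjective : Function.Surjective (toPolyQuot (n := n) v) := by
  intro x
  induction x using MvPolynomial.induction_on with
  | C a =>
    obtain ⟨s, rfl⟩ := Ideal.Quotient.mk_surjective a
    exact ⟨_, toPolyQuot_inclFst v s⟩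
  | add x y hx hy =>
    obtain ⟨p, rfl⟩ := hx
    obtain ⟨q, rfl⟩ := hy
    exact ⟨p + q, map_add _ _ _⟩
  | mul_X x j hx =>
    obtain ⟨p, rfl⟩ := hx
    exact ⟨p * X (Fin.natAdd l j), by rw [map_mul]; simp [toPolyQuot]⟩

theorem ker_toPolyQuot : RingHom.ker (toPolyQuot (n := n) v) =
    Ideal.span (Set.range fun i => inclFst l n (v i)) := by
  set J := Ideal.span (Set.range fun i => inclFst l n (v i)) with hJ
  apply le_antisymm
  · have hle : ∀ s ∈ Ideal.span (Set.range v), (Ideal.Quotient.mk J).comp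
        (inclFst l n).toRingHom s = 0 := by
      intro s hs
      refine Ideal.Quotient.eq_zero_iff_mem.2 ?_
      have := Ideal.mem_map_of_mem (inclFst l n) hs
      rw [Ideal.map_span, ← Set.range_comp] at this
      exact this
    -- Shows that `toPolyQuot` followed by β is reduction modulo J, so its kernel is contained in J.
    let β : MvPolynomial (Fin n) (MvPolynomial (Fin l) ℚ ⧸ Ideal.span (Set.range v)) →+*
        MvPolynomial (Fin (l + n)) ℚ ⧸ J :=
      eval₂Hom (Ideal.Quotient.lift _ _ hle) fun j => Ideal.Quotient.mk J (X (Fin.natAdd l j))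
    have hβ : β.comp (toPolyQuot (n := n) v).toRingHom = Ideal.Quotient.mk J := by
      apply MvPolynomial.ringHom_ext'
      · exact RingHom.ext_rat _ _
      · intro i
        induction i using Fin.addCases with
        | left i => simp [β, toPolyQuot, inclFst]
        | right j => simp [β, toPolyQuot]
    intro p hp
    refine Ideal.Quotient.eq_zero_iff_mem.1 ?_
    rw [← hβ]
    show β (toPolyQuot v p) = 0
    rw [RingHom.mem_ker.1 hp, map_zero]
  · rw [hJ, Ideal.span_le]
    rintro _ ⟨i, rfl⟩
    show toPolyQuot v (inclFst l n (v i)) = 0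
    rw [toPolyQuot_inclFst, Ideal.Quotient.eq_zero_iff_mem.2 (Ideal.subset_span (Set.mem_range_self i)),
      map_zero]

/-- The relations in v come first in the sequence. Dividing them out turns the ideal of all
relations before u_{l+j} into the ideal of the remaining ones, so regularity carries over. -/
theorem regularFamily_toPolyQuot (hv : ∀ i, inclFst l n (v i) = H.rel (Fin.castAdd n i)) :
    RegularFamily fun j => toPolyQuot v (H.rel (Fin.natAdd l j)) := by
  have hker : RingHom.ker (toPolyQuot (n := n) v) =
      Ideal.span (Set.range fun i => H.rel (Fin.castAdd n i)) := by
    rw [ker_toPolyQuot]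
    simp only [hv]
  have key : ∀ (j : Fin n) p, toPolyQuot v p ∈
      Ideal.span ((fun j => toPolyQuot v (H.rel (Fin.natAdd l j))) '' Set.Iio j) ↔
      p ∈ Ideal.span (H.rel '' Set.Iio (Fin.natAdd l j)) := by
    intro j p
    have h1 := mem_span_image_iff_of_surjective (A := MvPolynomial (Fin (l + n)) ℚ)
      (B := MvPolynomial (Fin n) (MvPolynomial (Fin l) ℚ ⧸ Ideal.span (Set.range v)))
      (toPolyQuot (n := n) v) (toPolyQuot_surjective v)
      (fun j : Fin n => H.rel (Fin.natAdd l j)) (Set.Iio j) p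
    refine h1.trans ?_
    rw [hker, ← Ideal.span_union]
    have e2 : (fun j : Fin n => H.rel (Fin.natAdd l j)) '' Set.Iio j ∪
        Set.range (fun i => H.rel (Fin.castAdd n i)) = H.rel '' Set.Iio (Fin.natAdd l j) := by
      ext r
      constructor
      · rintro (⟨i, hi, rfl⟩ | ⟨i, rfl⟩)
        · exact ⟨Fin.natAdd l i, by simpa using hi, rfl⟩
        · exact ⟨Fin.castAdd n i, by simp [Fin.lt_def]; omega, rfl⟩
      · rintro ⟨i, hi, rfl⟩
        induction i using Fin.addCases with
        | left i => exact Or.inr ⟨i, rfl⟩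
        | right i => exact Or.inl ⟨i, by simpa using hi, rfl⟩
    rw [e2]
  intro j x hx
  obtain ⟨p, rfl⟩ := toPolyQuot_surjective v x
  rw [← map_mul, key] at hx
  rw [key]
  exact H.regularFamily _ _ hx

end Split

end PositivelyElliptic

namespace PositivelyElliptic

section Split

variable {l n : ℕ} (H : PositivelyElliptic (l + n)) (v : Fin l → MvPolynomial (Fin l) ℚ)

/-- The augmentation of `ℚ[x₁,…,x_l] / (v)`. -/
noncomputable def augmentation (hv0 : ∀ i, constantCoeff (v i) = 0) :
    (MvPolynomial (Fin l) ℚ ⧸ Ideal.span (Set.range v)) →ₐ[ℚ] ℚ :=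
  Ideal.Quotient.liftₐ _ (aeval fun _ => (0 : ℚ)) fun s hs => by
    have h1 : Ideal.span (Set.range v) ≤ RingHom.ker (aeval fun _ : Fin l => (0 : ℚ)) := by
      rw [Ideal.span_le]
      rintro _ ⟨i, rfl⟩
      have := hv0 i
      simpa [aeval_zero'] using this
    exact h1 hs

theorem augmentation_mk (hv0 : ∀ i, constantCoeff (v i) = 0) (s : MvPolynomial (Fin l) ℚ) :
    augmentation v hv0 (Ideal.Quotient.mk _ s) = constantCoeff s := by
  show aeval (fun _ => (0 : ℚ)) s = _
  simp [aeval_zero']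

theorem augmentation_surjective (hv0 : ∀ i, constantCoeff (v i) = 0) :
    Function.Surjective (augmentation v hv0) := fun q =>
  ⟨Ideal.Quotient.mk _ (C q), by rw [augmentation_mk, constantCoeff_C]⟩

/-- The ideal is generated by the classes of finitely many variables, each of them nilpotent. -/
theorem isNilpotent_ker_augmentation (hv0 : ∀ i, constantCoeff (v i) = 0)
    (hnil : ∀ i, ∃ N, (X i : MvPolynomial (Fin l) ℚ) ^ N ∈ Ideal.span (Set.range v)) :
    IsNilpotent (RingHom.ker (augmentation v hv0)) := by
  rw [Ideal.FG.isNilpotent_iff_le_nilradical (IsNoetherian.noetherian _)]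
  intro x hx
  obtain ⟨s, rfl⟩ := Ideal.Quotient.mk_surjective x
  rw [RingHom.mem_ker, augmentation_mk, ← mem_idealOfVars_iff] at hx
  have h1 := Ideal.mem_map_of_mem (Ideal.Quotient.mk (Ideal.span (Set.range v))) hx
  rw [Ideal.map_span] at h1
  refine (Ideal.span_le.2 ?_) h1
  rintro _ ⟨_, ⟨i, rfl⟩, rfl⟩
  obtain ⟨N, hN⟩ := hnil i
  exact ⟨N, by rw [← map_pow]; exact Ideal.Quotient.eq_zero_iff_mem.2 hN⟩

theorem map_augmentation_toPolyQuot (hv0 : ∀ i, constantCoeff (v i) = 0)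
    (p : MvPolynomial (Fin (l + n)) ℚ) :
    mapAlgHom (augmentation v hv0) (toPolyQuot v p) = projSnd l n p := by
  have : (mapAlgHom (augmentation v hv0)).comp (toPolyQuot v) = projSnd l n := by
    apply MvPolynomial.algHom_ext
    intro i
    induction i using Fin.addCases with
    | left i =>
      simp [toPolyQuot, projSnd, augmentation_mk]
    | right j => simp [toPolyQuot, projSnd]
  exact AlgHom.congr_fun this p

variable {H v} in
-- Setting the first variables to zero is reduction modulo the augmentation ideal of ℚ[x_0, …,
-- x_{l-1}]/(v). Regularity survives this reduction because that ideal is maximal and nilpotent.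
theorem regularFamily_projSnd (hv0 : ∀ i, constantCoeff (v i) = 0)
    (hv : ∀ i, inclFst l n (v i) = H.rel (Fin.castAdd n i)) :
    RegularFamily fun j => projSnd l n (H.rel (Fin.natAdd l j)) := by
  have : (RingHom.ker (augmentation v hv0)).IsMaximal :=
    RingHom.ker_isMaximal_of_surjective _ (augmentation_surjective v hv0)
  have hnil := isNilpotent_ker_augmentation v hv0 (subModel H v hv).exists_X_pow_mem
  have h1 := (projective_quotient_regularFamily hnil (regularFamily_toPolyQuot H v hv)).2
  have hsurj : Function.Surjective (mapAlgHom (σ := Fin n) (augmentation v hv0)) :=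
    map_surjective _ (augmentation_surjective v hv0)
  have h2 := fun (j : Fin n) x => mem_span_image_iff_of_surjective
    (mapAlgHom (σ := Fin n) (augmentation v hv0)) hsurj
    (fun j => toPolyQuot v (H.rel (Fin.natAdd l j))) (Set.Iio j) x
  simp only [map_augmentation_toPolyQuot, ker_mapAlgHom] at h2
  intro j x hx
  obtain ⟨y, rfl⟩ := hsurj x
  have e : projSnd l n (H.rel (Fin.natAdd l j)) * mapAlgHom (augmentation v hv0) y =
      mapAlgHom (augmentation v hv0) (toPolyQuot v (H.rel (Fin.natAdd l j)) * y) := by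
    rw [map_mul, map_augmentation_toPolyQuot]
  rw [e, h2] at hx
  rw [h2]
  exact h1 j y hx

variable {H v} in
-- This is the injectivity of the subalgebra into H. The algebra H is projective over it, and
-- evaluating all variables at zero provides the map χ that shows faithfulness.
theorem mem_of_inclFst_mem (h0 : ∀ i, constantCoeff (H.rel i) = 0)
    (hv0 : ∀ i, constantCoeff (v i) = 0)
    (hv : ∀ i, inclFst l n (v i) = H.rel (Fin.castAdd n i)) {s : MvPolynomial (Fin l) ℚ}
    (hs : inclFst l n s ∈ H.relIdeal) : s ∈ Ideal.span (Set.range v) := by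
  have : (RingHom.ker (augmentation v hv0)).IsMaximal :=
    RingHom.ker_isMaximal_of_surjective _ (augmentation_surjective v hv0)
  have hnil := isNilpotent_ker_augmentation v hv0 (subModel H v hv).exists_X_pow_mem
  have h1 : C (Ideal.Quotient.mk _ s) ∈
      Ideal.span (Set.range fun j => toPolyQuot v (H.rel (Fin.natAdd l j))) := by
    rw [← toPolyQuot_inclFst]
    have hle : H.relIdeal ≤ (Ideal.span (Set.range fun j =>
        toPolyQuot v (H.rel (Fin.natAdd l j)))).comap (toPolyQuot v) := by
      rw [Ideal.span_le]
      rintro _ ⟨i, rfl⟩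
      induction i using Fin.addCases with
      | left i =>
        rw [← hv, SetLike.mem_coe, Ideal.mem_comap, toPolyQuot_inclFst,
          Ideal.Quotient.eq_zero_iff_mem.2 (Ideal.subset_span (Set.mem_range_self i)), map_zero]
        exact zero_mem _
      | right j => exact Ideal.subset_span ⟨j, rfl⟩
    exact hle hs
  let χ : MvPolynomial (Fin n) (MvPolynomial (Fin l) ℚ ⧸ Ideal.span (Set.range v)) →ₐ[ℚ] ℚ :=
    (aeval fun _ => (0 : ℚ)).comp (mapAlgHom (augmentation v hv0))
  refine Ideal.Quotient.eq_zero_iff_mem.1 (eq_zero_of_algebraMap_mem_span_regularFamily hnil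
    (regularFamily_toPolyQuot H v hv) χ.toRingHom (fun r hr => ?_) (fun j => ?_) h1)
  · have : augmentation v hv0 r = 0 := hr
    show χ (C r) = 0
    simp [χ, this]
  · have h2 : projSnd l n (H.rel (Fin.natAdd l j)) ∈ idealOfVars _ ℚ ^ 1 := by
      refine aeval_mem_pow_idealOfVars (fun i => ?_) ?_
      · induction i using Fin.addCases with
        | left i => simp
        | right j => simpa using Ideal.subset_span (Set.mem_range_self j)
      · rw [pow_one, mem_idealOfVars_iff]
        exact h0 _
    rw [pow_one, mem_idealOfVars_iff] at h2
    show aeval (fun _ => (0 : ℚ)) (mapAlgHom (augmentation v hv0) (toPolyQuot v _)) = 0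
    rw [map_augmentation_toPolyQuot, aeval_zero', h2, map_zero]

variable {H v} in
-- The subalgebra has relations v; the quotient has the other relations with the first variables set
-- to zero. Both are non-trivial since relations without linear terms cannot kill a variable.
theorem splits_of_inclFst (hH : H.IsPureModel) (hl : 0 < l) (hn : 0 < n)
    (hv : ∀ i, inclFst l n (v i) = H.rel (Fin.castAdd n i)) : H.Splits := by
  have hsq : ∀ i, H.rel i ∈ idealOfVars _ ℚ ^ 2 := fun i =>
    (mem_pow_idealOfVars_iff 2 _).2 (hH.two_le i)
  have hfst : ∀ i, (Fin.addCases (motive := fun _ => MvPolynomial (Fin l) ℚ) X (fun _ : Fin n => 0) i) ∈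
      idealOfVars (Fin l) ℚ := by
    intro i
    induction i using Fin.addCases with
    | left i => simpa using Ideal.subset_span (Set.mem_range_self i)
    | right j => simp
  have hsnd : ∀ i, (Fin.addCases (motive := fun _ => MvPolynomial (Fin n) ℚ) (fun _ : Fin l => 0) X i) ∈
      idealOfVars (Fin n) ℚ := by
    intro i
    induction i using Fin.addCases with
    | left i => simp
    | right j => simpa using Ideal.subset_span (Set.mem_range_self j)
  have hvsq : ∀ i, v i ∈ idealOfVars _ ℚ ^ 2 := by
    intro i
    rw [← projFst_inclFst (n := n) (v i), hv]
    exact aeval_mem_pow_idealOfVars hfst (hsq _)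
  have hv0 : ∀ i, constantCoeff (v i) = 0 := fun i =>
    mem_idealOfVars_iff.1 (Ideal.pow_le_self two_ne_zero (hvsq i))
  have hqsq : ∀ i, projSnd l n (H.rel i) ∈ idealOfVars _ ℚ ^ 2 := fun i =>
    aeval_mem_pow_idealOfVars hsnd (hsq _)
  have hwfst : ∀ i, IsWeightedHomogeneous H.deg (X (Fin.castAdd n i) : MvPolynomial _ ℚ)
      (H.deg (Fin.castAdd n i)) := fun i => isWeightedHomogeneous_X ℚ _ _
  have hwsnd : ∀ i, IsWeightedHomogeneous (fun j => H.deg (Fin.natAdd l j))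
      (Fin.addCases (motive := fun _ => MvPolynomial (Fin n) ℚ) (fun _ : Fin l => 0) X i)
      (H.deg i) := by
    intro i
    induction i using Fin.addCases with
    | left i => simpa using isWeightedHomogeneous_zero ℚ _ _
    | right j => simpa using isWeightedHomogeneous_X ℚ (fun j => H.deg (Fin.natAdd l j)) j
  let K : PositivelyElliptic l := subModel H v hv
  let Q : PositivelyElliptic n :=
    { deg := fun j => H.deg (Fin.natAdd l j)
      rel := fun j => projSnd l n (H.rel (Fin.natAdd l j))
      relDeg := fun j => H.relDeg (Fin.natAdd l j)
      deg_pos := fun _ => H.deg_pos _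
      deg_even := fun _ => H.deg_even _
      rel_homogeneous := fun j => isWeightedHomogeneous_aeval hwsnd (H.rel_homogeneous _)
      rel_regular := (isWeaklyRegular_ofFn_iff _).2 (regularFamily_projSnd hv0 hv) }
  have hproj0 : ∀ i, projSnd l n (H.rel (Fin.castAdd n i)) = 0 := by
    intro i
    rw [← hv, ← map_augmentation_toPolyQuot v hv0, toPolyQuot_inclFst,
      Ideal.Quotient.eq_zero_iff_mem.2 (Ideal.subset_span (Set.mem_range_self i)), map_zero, map_zero]
  have hf : K.relIdeal ≤ H.relIdeal.comap (inclFst l n) := by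
    rw [Ideal.span_le]
    rintro _ ⟨i, rfl⟩
    exact Ideal.subset_span ⟨Fin.castAdd n i, (hv i).symm⟩
  have hg : H.relIdeal ≤ Q.relIdeal.comap (projSnd l n) := by
    rw [Ideal.span_le]
    rintro _ ⟨i, rfl⟩
    rw [SetLike.mem_coe, Ideal.mem_comap]
    induction i using Fin.addCases with
    | left i => rw [hproj0]; exact zero_mem _
    | right j => exact Ideal.subset_span ⟨j, rfl⟩
  let f : K.Alg →ₐ[ℚ] H.Alg := Ideal.quotientMapₐ _ (inclFst l n) hf
  let g : H.Alg →ₐ[ℚ] Q.Alg := Ideal.quotientMapₐ _ (projSnd l n) hg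
  have hfm : ∀ s, f (Ideal.Quotient.mk _ s) = Ideal.Quotient.mk _ (inclFst l n s) := fun s => rfl
  have hgm : ∀ s, g (Ideal.Quotient.mk _ s) = Ideal.Quotient.mk _ (projSnd l n s) := fun s => rfl
  have hfpiece : ∀ n, ∀ x ∈ K.piece n, f x ∈ H.piece n := by
    intro d x hx
    obtain ⟨p, hp, rfl⟩ := K.mem_piece.1 hx
    rw [hfm]
    exact H.mem_piece.2 ⟨_, isWeightedHomogeneous_aeval hwfst hp, rfl⟩
  have hne : ∀ {k : ℕ} (E : PositivelyElliptic k), 0 < k → (∀ i, E.rel i ∈ idealOfVars _ ℚ ^ 2) →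
      E.IsNontrivial := by
    intro k E hk hE
    refine ⟨E.deg ⟨0, hk⟩, E.deg_pos _, fun hbot => ?_⟩
    have h1 : Ideal.Quotient.mk E.relIdeal (X ⟨0, hk⟩) ∈ E.piece (E.deg ⟨0, hk⟩) :=
      E.mem_piece.2 ⟨_, isWeightedHomogeneous_X ℚ _ _, rfl⟩
    rw [hbot] at h1
    refine X_notMem_of_le_sq ?_ _ (Ideal.Quotient.eq_zero_iff_mem.1 h1)
    rw [Ideal.span_le]
    rintro _ ⟨i, rfl⟩
    exact hE i
  refine ⟨l, n, K, Q, f, g, hne K hl hvsq, hne Q hn fun j => hqsq _, hfpiece, ?_, ?_, ?_, ?_⟩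
  · intro d x hx
    obtain ⟨p, hp, rfl⟩ := H.mem_piece.1 hx
    rw [hgm]
    exact Q.mem_piece.2 ⟨_, isWeightedHomogeneous_aeval hwsnd hp, rfl⟩
  · rw [injective_iff_map_eq_zero]
    intro x hx
    obtain ⟨s, rfl⟩ := Ideal.Quotient.mk_surjective x
    rw [hfm] at hx
    exact Ideal.Quotient.eq_zero_iff_mem.2
      (mem_of_inclFst_mem hH.constantCoeff_rel hv0 hv (Ideal.Quotient.eq_zero_iff_mem.1 hx))
  · intro y
    obtain ⟨q, rfl⟩ := Ideal.Quotient.mk_surjective y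
    obtain ⟨p, rfl⟩ := projSnd_surjective (l := l) q
    exact ⟨Ideal.Quotient.mk _ p, hgm p⟩
  · apply le_antisymm
    · intro x hx
      obtain ⟨p, rfl⟩ := Ideal.Quotient.mk_surjective x
      rw [RingHom.mem_ker, hgm, Ideal.Quotient.eq_zero_iff_mem] at hx
      have h1 := mem_span_image_iff_of_surjective (projSnd l n) projSnd_surjective
        (fun j : Fin n => H.rel (Fin.natAdd l j)) Set.univ p
      simp only [Set.image_univ] at h1
      obtain ⟨a, ha, b, hb, rfl⟩ := Submodule.mem_sup.1 (h1.1 hx)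
      have ha' : a ∈ H.relIdeal := by
        refine Ideal.span_mono ?_ ha
        rintro _ ⟨j, rfl⟩
        exact ⟨_, rfl⟩
      rw [map_add, Ideal.Quotient.eq_zero_iff_mem.2 ha', zero_add]
      have h2 := Ideal.mem_map_of_mem (Ideal.Quotient.mk H.relIdeal) (ker_projSnd_le hb)
      rw [Ideal.map_span] at h2
      refine Ideal.span_mono ?_ h2
      rintro _ ⟨_, ⟨i, rfl⟩, rfl⟩
      refine ⟨K.deg i, K.deg_pos i, Ideal.Quotient.mk _ (X i),
        K.mem_piece.2 ⟨_, isWeightedHomogeneous_X ℚ _ _, rfl⟩, ?_⟩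
      rw [hfm]
      simp [inclFst]
    · rw [Ideal.span_le]
      rintro _ ⟨d, hd, x, hx, rfl⟩
      obtain ⟨s, hs, rfl⟩ := K.mem_piece.1 hx
      rw [SetLike.mem_coe, RingHom.mem_ker, hfm, hgm]
      have : constantCoeff s = 0 := hs.coeff_eq_zero 0 (by simpa using hd.ne)
      have e : projSnd l n (inclFst l n s) = C (constantCoeff s) := by
        rw [← map_augmentation_toPolyQuot v hv0, toPolyQuot_inclFst, mapAlgHom_apply, map_C]
        exact congrArg C (augmentation_mk v hv0 s)
      rw [e, this, map_zero, map_zero]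

end Split

end PositivelyElliptic

/-! ### Lifting derivations, and the degree inequality in the absence of splitting -/

theorem eq_zero_of_pderiv_eq_zero {σ : Type*} {p : MvPolynomial σ ℚ} {i : σ} (hp : pderiv i p = 0)
    {d : σ →₀ ℕ} (hd : d ∈ p.support) : d i = 0 := by
  by_contra h
  have h1 := coeff_pderiv (i := i) p (d - Finsupp.single i 1)
  have h2 : d - Finsupp.single i 1 + Finsupp.single i 1 = d :=
    tsub_add_cancel_of_le (Finsupp.single_le_iff.2 (Nat.one_le_iff_ne_zero.2 h))
  rw [hp, coeff_zero, h2] at h1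
  rcases mul_eq_zero.1 h1.symm with h3 | h3
  · exact mem_support_iff.1 hd h3
  · exact absurd h3 (by positivity)

theorem mkDerivation_eq_sum {k : ℕ} (p : Fin k → MvPolynomial (Fin k) ℚ)
    (f : MvPolynomial (Fin k) ℚ) : mkDerivation ℚ p f = ∑ i, p i * pderiv i f := by
  classical
  have hsum : ∀ (s : Finset (Fin k)) g, (∑ i ∈ s, p i • pderiv (R := ℚ) i) g =
      ∑ i ∈ s, p i * pderiv i g := by
    intro s g
    induction s using Finset.induction with
    | empty => simp
    | insert a s ha ih => rw [Finset.sum_insert ha, Finset.sum_insert ha, Derivation.add_apply, ih]; rfl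
  have : mkDerivation ℚ p = ∑ i, p i • pderiv i := by
    apply derivation_ext
    intro j
    rw [mkDerivation_X, hsum]
    simp [pderiv_X, Pi.single_apply]
  rw [this, hsum]

/-- Replace each coefficient by its component of degree e - b_i; for b_i > e no such component
exists, so relations of larger degree do not contribute. -/
theorem exists_of_homogeneous_mem {k m : ℕ} {w : Fin k → ℕ} {u : Fin m → MvPolynomial (Fin k) ℚ}
    {b : Fin m → ℕ} (hu : ∀ i, IsWeightedHomogeneous w (u i) (b i)) {f : MvPolynomial (Fin k) ℚ}
    {e : ℕ} (hf : IsWeightedHomogeneous w f e) (hfI : f ∈ Ideal.span (Set.range u)) :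
    ∃ c : Fin m → MvPolynomial (Fin k) ℚ, f = ∑ i, c i * u i ∧ ∀ i, e < b i → c i = 0 := by
  obtain ⟨c, hc⟩ := Ideal.mem_span_range_iff_exists_fun.1 hfI
  refine ⟨fun i => if b i ≤ e then weightedHomogeneousComponent w (e - b i) (c i) else 0, ?_,
    fun i hi => if_neg (not_le.2 hi)⟩
  rw [← hf.weightedHomogeneousComponent_same, ← hc, map_sum]
  refine Finset.sum_congr rfl fun i _ => ?_
  rw [mul_comm, component_mul_of_homogeneous (hu i)]
  by_cases h : b i ≤ e
  · simp only [if_pos h, mul_comm]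
  · simp only [if_neg h, zero_mul]

theorem weight_le_of_mem_support {σ : Type*} {w : σ → ℕ} {f : MvPolynomial σ ℚ} {e : ℕ}
    (hf : IsWeightedHomogeneous w f e) {d : σ →₀ ℕ} (hd : d ∈ f.support) {i : σ} (hi : d i ≠ 0) :
    w i ≤ e := by
  rw [← hf (mem_support_iff.1 hd)]
  exact Finsupp.le_weight_of_ne_zero' w hi

/-- The alternative avoids truncated subtraction: the image has degree m - t, and it is zero when t
exceeds m. -/
theorem homogeneous_mkDerivation {k : ℕ} {w : Fin k → ℕ} {p : Fin k → MvPolynomial (Fin k) ℚ}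
    {t : ℕ} (hp : ∀ i, p i ≠ 0 → ∃ e, e + t = w i ∧ IsWeightedHomogeneous w (p i) e)
    {f : MvPolynomial (Fin k) ℚ} {m : ℕ} (hf : IsWeightedHomogeneous w f m) :
    (∃ m', m' + t = m ∧ IsWeightedHomogeneous w (mkDerivation ℚ p f) m') ∨
      mkDerivation ℚ p f = 0 := by
  have hterm : ∀ i, p i * pderiv i f ≠ 0 →
      ∃ m', m' + t = m ∧ IsWeightedHomogeneous w (p i * pderiv i f) m' := by
    intro i hi
    obtain ⟨e, he, hpe⟩ := hp i (left_ne_zero_of_mul hi)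
    have hwi : w i ≤ m := by
      obtain ⟨d, hd⟩ := support_nonempty.2 (right_ne_zero_of_mul hi)
      rw [mem_support_iff, coeff_pderiv] at hd
      exact weight_le_of_mem_support hf (mem_support_iff.2 (left_ne_zero_of_mul hd)) (i := i)
        (by simp)
    refine ⟨m - t, by omega, ?_⟩
    have h1 : IsWeightedHomogeneous w (pderiv i f) (m - w i) := by
      intro d hd
      rw [coeff_pderiv] at hd
      have := hf (left_ne_zero_of_mul hd)
      rw [map_add, Finsupp.weight_single, one_smul] at this
      omega
    have h2 := hpe.mul h1
    rwa [show e + (m - w i) = m - t by omega] at h2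
  rw [mkDerivation_eq_sum]
  by_cases ht : t ≤ m
  · left
    refine ⟨m - t, by omega, IsWeightedHomogeneous.sum _ _ _ fun i _ => ?_⟩
    by_cases h0 : p i * pderiv i f = 0
    · rw [h0]; exact isWeightedHomogeneous_zero ℚ _ _
    · obtain ⟨m', hm', h⟩ := hterm i h0
      rwa [show m - t = m' by omega]
  · right
    refine Finset.sum_eq_zero fun i _ => ?_
    by_contra h0
    obtain ⟨m', hm', -⟩ := hterm i h0
    omega

namespace PositivelyElliptic

variable {k : ℕ} {H : PositivelyElliptic k}

/-- Let n be minimal with x^n = 0. Applying δ gives n c x^{n-1} = 0, and characteristic 0 forces c =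
0. This excludes degree 0 values on generators in the lift of δ. -/
theorem derivation_ne_one (h0 : ∀ i, constantCoeff (H.rel i) = 0)
    (δ : Derivation ℚ H.Alg H.Alg) (i : Fin k) {c : ℚ}
    (hc : δ (Ideal.Quotient.mk _ (X i)) = algebraMap ℚ H.Alg c) : c = 0 := by
  classical
  by_contra hc0
  set x : H.Alg := Ideal.Quotient.mk _ (X i) with hx
  have hex : ∃ n, x ^ n = 0 := by
    obtain ⟨n, hn⟩ := H.exists_X_pow_mem i
    exact ⟨n, by rw [hx, ← map_pow]; exact Ideal.Quotient.eq_zero_iff_mem.2 hn⟩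
  have hne : Nat.find hex ≠ 0 := by
    intro h
    have h1 := Nat.find_spec hex
    rw [h, pow_zero, ← map_one (Ideal.Quotient.mk _), Ideal.Quotient.eq_zero_iff_mem] at h1
    have := constantCoeff_of_mem h0 h1
    simp at this
  have h2 := congrArg δ (Nat.find_spec hex)
  rw [map_zero, δ.leibniz_pow, hc, smul_eq_mul, mul_comm, ← Algebra.smul_def,
    ← Nat.cast_smul_eq_nsmul ℚ, smul_smul] at h2
  have h3 := (smul_eq_zero.1 h2).resolve_left (mul_ne_zero (Nat.cast_ne_zero.2 hne) hc0)
  exact Nat.find_min hex (Nat.sub_lt (Nat.pos_of_ne_zero hne) one_pos) h3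

/-- A derivation of negative degree lifts to a homogeneous derivation of the polynomial ring. -/
theorem exists_lift (h0 : ∀ i, constantCoeff (H.rel i) = 0) {δ : Derivation ℚ H.Alg H.Alg} {t : ℕ}
    (hδ : H.LowersDegreeBy δ t) :
    ∃ p : Fin k → MvPolynomial (Fin k) ℚ,
      (∀ i, p i ≠ 0 → ∃ e, e + t = H.deg i ∧ 0 < e ∧ IsWeightedHomogeneous H.deg (p i) e) ∧
      ∀ f, Ideal.Quotient.mk H.relIdeal (mkDerivation ℚ p f) = δ (Ideal.Quotient.mk H.relIdeal f) := by
  have hex : ∀ i, ∃ q : MvPolynomial (Fin k) ℚ,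
      (q ≠ 0 → ∃ e, e + t = H.deg i ∧ 0 < e ∧ IsWeightedHomogeneous H.deg q e) ∧
      Ideal.Quotient.mk H.relIdeal q = δ (Ideal.Quotient.mk H.relIdeal (X i)) := by
    intro i
    have hX : ∀ n, n = H.deg i → Ideal.Quotient.mk H.relIdeal (X i) ∈ H.piece n := by
      rintro _ rfl
      exact H.mem_piece.2 ⟨_, isWeightedHomogeneous_X ℚ _ _, rfl⟩
    by_cases ht : t ≤ H.deg i
    · obtain ⟨q, hq, hqδ⟩ := H.mem_piece.1 (hδ.1 (H.deg i - t) _ (hX _ (by omega)))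
      by_cases he : H.deg i - t = 0
      · rw [he] at hq
        have hqC : q = C (constantCoeff q) := by
          ext d
          rw [coeff_C]
          split_ifs with hd
          · rw [← hd]; rfl
          · refine hq.coeff_eq_zero d fun hw => hd ?_
            rw [weight_eq_sum] at hw
            ext j
            have := (Finset.sum_eq_zero_iff.1 hw) j (Finset.mem_univ _)
            exact ((mul_eq_zero.1 this).resolve_right (H.deg_ne_zero j)).symm
        have hc : constantCoeff q = 0 := by
          refine derivation_ne_one h0 δ i ?_
          rw [← hqδ, hqC]
          simp
          rfl
        rw [hc, map_zero] at hqC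
        exact ⟨0, fun h => absurd rfl h, by rw [← hqδ, hqC]⟩
      · exact ⟨q, fun _ => ⟨_, by omega, by omega, hq⟩, hqδ⟩
    · exact ⟨0, fun h => absurd rfl h, by
        rw [map_zero, hδ.2 _ (by omega) _ (hX _ rfl)]⟩
  choose p hp hpδ using hex
  refine ⟨p, hp, fun f => ?_⟩
  induction f using MvPolynomial.induction_on with
  | C a =>
    have : Ideal.Quotient.mk H.relIdeal (C a) = algebraMap ℚ H.Alg a := rfl
    rw [derivation_C, this, Derivation.map_algebraMap, map_zero]
  | add f g hf hg => rw [map_add, map_add, map_add, map_add, hf, hg]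
  | mul_X f i hf =>
    rw [Derivation.leibniz, mkDerivation_X, map_mul, Derivation.leibniz, map_add, smul_eq_mul,
      smul_eq_mul, map_mul, map_mul, hf, hpδ, smul_eq_mul, smul_eq_mul]

theorem eq_zero_of_lift {δ : Derivation ℚ H.Alg H.Alg} {p : Fin k → MvPolynomial (Fin k) ℚ}
    (hp : ∀ f, Ideal.Quotient.mk H.relIdeal (mkDerivation ℚ p f) =
      δ (Ideal.Quotient.mk H.relIdeal f)) (h : ∀ i, p i ∈ H.relIdeal) : δ = 0 := by
  ext x
  obtain ⟨f, rfl⟩ := Ideal.Quotient.mk_surjective x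
  rw [← hp, mkDerivation_eq_sum]
  exact Ideal.Quotient.eq_zero_iff_mem.2
    (Submodule.sum_mem _ fun i _ => Ideal.mul_mem_right _ _ (h i))

theorem mkDerivation_rel_mem {δ : Derivation ℚ H.Alg H.Alg} {p : Fin k → MvPolynomial (Fin k) ℚ}
    (hp : ∀ f, Ideal.Quotient.mk H.relIdeal (mkDerivation ℚ p f) =
      δ (Ideal.Quotient.mk H.relIdeal f)) (i : Fin k) : mkDerivation ℚ p (H.rel i) ∈ H.relIdeal := by
  rw [← Ideal.Quotient.eq_zero_iff_mem, hp,
    Ideal.Quotient.eq_zero_iff_mem.2 (Ideal.subset_span (Set.mem_range_self i)), map_zero]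

theorem inclFst_projFst {l n : ℕ} {p : MvPolynomial (Fin (l + n)) ℚ}
    (h : ∀ d ∈ p.support, ∀ j, d (Fin.natAdd l j) = 0) : inclFst l n (projFst l n p) = p := by
  have := hom_congr_vars (f₁ := ((inclFst l n).comp (projFst l n)).toRingHom) (f₂ := RingHom.id _)
    (p₁ := p) (RingHom.ext_rat _ _) ?_ rfl
  · exact this
  · intro j hj _
    induction j using Fin.addCases with
    | left j => simp [inclFst, projFst]
    | right j =>
      obtain ⟨d, hd, hdj⟩ := (mem_vars_iff_mem_support _).1 hj
      exact absurd (h d hd j) (Finsupp.mem_support_iff.1 hdj)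

theorem splits_of_support {l n : ℕ} {H : PositivelyElliptic (l + n)} (hH : H.IsPureModel)
    (hl : 0 < l) (hn : 0 < n)
    (h : ∀ i : Fin l, ∀ d ∈ (H.rel (Fin.castAdd n i)).support, ∀ j, d (Fin.natAdd l j) = 0) :
    H.Splits :=
  splits_of_inclFst (v := fun i => projFst l n (H.rel (Fin.castAdd n i))) hH hl hn fun i =>
    inclFst_projFst (h i)

/-- A monomial of length at least 2 that contains x_j has a further factor, whose degree is at least
that of the first generator. -/
theorem IsPureModel.deg_add_deg_le_of_mem (hH : H.IsPureModel) (hk : 0 < k) {i : Fin k}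
    {d : Fin k →₀ ℕ} (hd : d ∈ (H.rel i).support) {j : Fin k} (hdj : d j ≠ 0) :
    H.deg ⟨0, hk⟩ + H.deg j ≤ H.relDeg i := by
  set d' := d - Finsupp.single j 1
  have hdd : d = d' + Finsupp.single j 1 :=
    (tsub_add_cancel_of_le (Finsupp.single_le_iff.2 (Nat.one_le_iff_ne_zero.2 hdj))).symm
  have hw : H.relDeg i = Finsupp.weight H.deg d :=
    (H.rel_homogeneous _ (mem_support_iff.1 hd)).symm
  have h2 := hH.two_le _ d hd
  have hne : d' ≠ 0 := by
    intro h
    rw [hdd, h, zero_add, Finsupp.degree_single] at h2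
    omega
  obtain ⟨i', hi'⟩ := Finsupp.ne_iff.1 hne
  have h3 : H.deg i' ≤ Finsupp.weight H.deg d' := Finsupp.le_weight_of_ne_zero' _ hi'
  have h4 : H.deg ⟨0, hk⟩ ≤ H.deg i' := hH.deg_mono (Fin.mk_le_of_le_val (Nat.zero_le _))
  rw [hdd, map_add, Finsupp.weight_single, one_smul] at hw
  omega

/-- If `H` has no non-trivial subalgebra, then `|u_l| ≥ |x_1| + |x_{l+1}|`. -/
theorem IsPureModel.deg_add_deg_le (hH : H.IsPureModel) (hs : ¬ H.Splits) {l : ℕ} (hl : l + 1 < k) :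
    H.deg ⟨0, by omega⟩ + H.deg ⟨l + 1, hl⟩ ≤ H.relDeg ⟨l, by omega⟩ := by
  by_contra! hlt
  obtain ⟨n, rfl⟩ : ∃ n, k = (l + 1) + (n + 1) := ⟨k - l - 2, by omega⟩
  -- If the bound failed, the first l + 1 relations would all be too small in degree to contain a
  -- later variable.
  refine hs (splits_of_support hH (Nat.succ_pos _) (Nat.succ_pos _) fun i d hd j => ?_)
  by_contra hdj
  have h1 := hH.deg_add_deg_le_of_mem (by omega) hd hdj
  have h5 : H.deg ⟨l + 1, hl⟩ ≤ H.deg (Fin.natAdd (l + 1) j) :=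
    hH.deg_mono (Fin.mk_le_of_le_val (by simp))
  have h6 : H.relDeg (Fin.castAdd (n + 1) i) ≤ H.relDeg ⟨l, by omega⟩ := by
    refine hH.relDeg_mono (Fin.le_def.2 ?_)
    have := i.2
    simp only [Fin.val_castAdd]
    omega
  omega

theorem eq_zero_of_homogeneous_lt {w : Fin k → ℕ} {f : MvPolynomial (Fin k) ℚ} {e : ℕ}
    (hf : IsWeightedHomogeneous w f e) (he : 0 < e) (hw : ∀ i, e < w i) : f = 0 := by
  by_contra h0
  obtain ⟨d, hd⟩ := support_nonempty.2 h0
  have hd0 : d ≠ 0 := by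
    rintro rfl
    have := hf (mem_support_iff.1 hd)
    rw [map_zero] at this
    omega
  obtain ⟨i, hi⟩ := Finsupp.ne_iff.1 hd0
  have := weight_le_of_mem_support hf hd hi
  have := hw i
  omega

/-- A homogeneous derivation of negative degree preserving the ideal of relations maps each relation
to a combination of the relations of smaller degree. -/
theorem mkDerivation_rel_eq_zero {u : Fin k → MvPolynomial (Fin k) ℚ} {w b : Fin k → ℕ}
    (hu : ∀ i, IsWeightedHomogeneous w (u i) (b i)) {p : Fin k → MvPolynomial (Fin k) ℚ} {t : ℕ}
    (ht : 0 < t) (hp : ∀ i, p i ≠ 0 → ∃ e, e + t = w i ∧ IsWeightedHomogeneous w (p i) e)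
    {i : Fin k} (hi : mkDerivation ℚ p (u i) ∈ Ideal.span (Set.range u)) :
    ∃ c : Fin k → MvPolynomial (Fin k) ℚ, mkDerivation ℚ p (u i) = ∑ j, c j * u j ∧
      ∀ j, b i ≤ b j → c j = 0 := by
  rcases homogeneous_mkDerivation hp (hu i) with ⟨m', hm', h⟩ | h
  · obtain ⟨c, hc, hc0⟩ := exists_of_homogeneous_mem hu h hi
    exact ⟨c, hc, fun j hj => hc0 j (by omega)⟩
  · exact ⟨0, by simp [h], fun j _ => rfl⟩

end PositivelyElliptic

/-! ### Derivations along the last of three variables -/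

/-- Let h be the gcd of a and q, with a = h a' and q = h q'. The condition on u makes a' divide
every coefficient of u of positive degree. If u has a unit coefficient there, a' is a unit and a
divides q. Otherwise v has one; after h is cancelled from the equation for v, reading off a
coefficient modulo (a', u(0)) puts q' into that ideal. -/
theorem mem_span_pair_of_derivative {S : Type*} [CommRing S] [IsDomain S]
    [UniqueFactorizationMonoid S] [Algebra ℚ S] {a q : S} {u v : Polynomial S} (ha : a ≠ 0)
    (hreg : ∀ g, Polynomial.C a ∣ u * g → Polynomial.C a ∣ g) (hu : Polynomial.C a ∣ Polynomial.C q * Polynomial.derivative u)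
    {f g : Polynomial S} (hv : Polynomial.C q * Polynomial.derivative v = f * Polynomial.C a + g * u) {n : ℕ} (hn : n ≠ 0)
    (hunit : IsUnit (u.coeff n) ∨ IsUnit (v.coeff n)) : q ∈ Ideal.span {a, u.coeff 0} := by
  have hnat : ∀ m : ℕ, m ≠ 0 → IsUnit (m : S) := by
    intro m hm
    have := (IsUnit.mk0 (m : ℚ) (Nat.cast_ne_zero.2 hm)).map (algebraMap ℚ S)
    rwa [map_natCast] at this
  have hn1 : n - 1 + 1 = n := Nat.sub_add_cancel (Nat.pos_of_ne_zero hn)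
  have hderiv : ∀ p : Polynomial S, (Polynomial.derivative p).coeff (n - 1) = p.coeff n * (n : S) := by
    intro p
    rw [Polynomial.coeff_derivative, hn1]
    congr 1
    exact_mod_cast congrArg (Nat.cast : ℕ → S) hn1
  obtain ⟨a', q', h, hrel, haa, hqq⟩ := UniqueFactorizationMonoid.exists_reduced_factors a ha q
  have hh0 : h ≠ 0 := by rintro rfl; exact ha (by rw [← haa, zero_mul])
  have ha0 : a' ≠ 0 := by rintro rfl; exact ha (by rw [← haa, mul_zero])
  have hcoeff : ∀ m, m ≠ 0 → a' ∣ u.coeff m := by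
    intro m hm
    obtain ⟨m, rfl⟩ := Nat.exists_eq_succ_of_ne_zero hm
    obtain ⟨c, hc⟩ := hu
    have h1 := congrArg (fun p => Polynomial.coeff p m) hc
    simp only [Polynomial.coeff_C_mul, Polynomial.coeff_derivative] at h1
    rw [← haa, ← hqq, mul_assoc, mul_assoc] at h1
    have h2 : a' ∣ q' * (u.coeff (m + 1) * ((m : S) + 1)) := ⟨_, mul_left_cancel₀ hh0 h1⟩
    have h3 := hrel.dvd_of_dvd_mul_left h2
    have h4 := hnat (m + 1) (Nat.succ_ne_zero m)
    push_cast at h4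
    exact h4.dvd_mul_right.1 h3
  rcases hunit with hun | hvn
  · have h1 : IsUnit a' := isUnit_of_dvd_unit (hcoeff n hn) hun
    have h2 : a ∣ q := by
      rw [← haa, ← hqq]
      exact mul_dvd_mul_left h h1.dvd
    exact Ideal.mem_of_dvd _ h2 (Ideal.subset_span (Set.mem_insert _ _))
  · have e1 : Polynomial.C h * (Polynomial.C q' * Polynomial.derivative v - f * Polynomial.C a') = g * u := by
      rw [mul_sub, ← mul_assoc, ← Polynomial.C_mul, hqq, hv, ← haa, Polynomial.C_mul]
      ring
    -- Regularity of u modulo a is used to show that h divides g, so that h can be cancelled from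
    -- the equation for v.
    have h1 : Polynomial.C a ∣ u * (g * Polynomial.C a') := by
      refine ⟨Polynomial.C q' * Polynomial.derivative v - f * Polynomial.C a', ?_⟩
      rw [← haa, Polynomial.C_mul]
      linear_combination -Polynomial.C a' * e1
    have h2 := hreg _ h1
    rw [← haa, Polynomial.C_mul] at h2
    obtain ⟨g', rfl⟩ := (mul_dvd_mul_iff_right (Polynomial.C_ne_zero.2 ha0)).1 h2
    have e2 : Polynomial.C q' * Polynomial.derivative v = f * Polynomial.C a' + g' * u := by
      refine mul_left_cancel₀ (Polynomial.C_ne_zero.2 hh0) ?_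
      linear_combination e1
    have hmem : ∀ m, u.coeff m ∈ Ideal.span {a', u.coeff 0} := by
      intro m
      by_cases hm : m = 0
      · rw [hm]; exact Ideal.subset_span (by simp)
      · exact Ideal.mem_of_dvd _ (hcoeff m hm) (Ideal.subset_span (by simp))
    -- All coefficients of u lie in (a', u(0)). The coefficient of degree n - 1 on the left is q'
    -- times n times the unit coefficient of v in degree n.
    have h3 : (Polynomial.C q' * Polynomial.derivative v).coeff (n - 1) =
        (f * Polynomial.C a' + g' * u).coeff (n - 1) := by rw [e2]
    rw [Polynomial.coeff_C_mul, hderiv, Polynomial.coeff_add, Polynomial.coeff_mul_C,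
      Polynomial.coeff_mul] at h3
    have h4 : q' * (v.coeff n * n) ∈ Ideal.span {a', u.coeff 0} := by
      rw [h3]
      exact add_mem (Ideal.mul_mem_left _ _ (Ideal.subset_span (by simp)))
        (Submodule.sum_mem _ fun x _ => Ideal.mul_mem_left _ _ (hmem _))
    rw [Ideal.mul_unit_mem_iff_mem _ (hvn.mul (hnat n hn))] at h4
    rw [← hqq]
    obtain ⟨x, y, hxy⟩ := Ideal.mem_span_pair.1 h4
    refine Ideal.mem_span_pair.2 ⟨x, h * y, ?_⟩
    rw [← hxy, ← haa]
    ring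

namespace PositivelyElliptic

/-- Polynomials in `l + 1` variables as polynomials in the last variable. -/
noncomputable def toPoly (l : ℕ) :
    MvPolynomial (Fin (l + 1)) ℚ ≃ₐ[ℚ] Polynomial (MvPolynomial (Fin l) ℚ) :=
  AlgEquiv.ofAlgHom
    (aeval (Fin.addCases (fun i => Polynomial.C (X i)) fun _ => Polynomial.X))
    (Polynomial.eval₂AlgHom (inclFst l 1) (X (Fin.natAdd l 0)) fun _ => Commute.all _ _)
    (by
      refine Polynomial.algHom_ext' (MvPolynomial.algHom_ext fun i => ?_) ?_
      · simp [inclFst]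
      · simp)
    (by
      apply MvPolynomial.algHom_ext
      intro i
      induction i using Fin.addCases with
      | left i => simp [inclFst]
      | right j => simp [Subsingleton.elim j 0])

theorem toPoly_X_castAdd {l : ℕ} (i : Fin l) :
    toPoly l (X (Fin.castAdd 1 i)) = Polynomial.C (X i) := by
  simp [toPoly]

theorem toPoly_X_natAdd {l : ℕ} (j : Fin 1) : toPoly l (X (Fin.natAdd l j)) = Polynomial.X := by
  simp [toPoly]

theorem toPoly_inclFst {l : ℕ} (s : MvPolynomial (Fin l) ℚ) :
    toPoly l (inclFst l 1 s) = Polynomial.C s := by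
  have : ((toPoly l).toAlgHom.comp (inclFst l 1)) = Polynomial.CAlgHom := by
    apply MvPolynomial.algHom_ext
    intro i
    simp [inclFst, toPoly_X_castAdd]
  exact AlgHom.congr_fun this s

theorem derivative_toPoly {l : ℕ} (p : MvPolynomial (Fin (l + 1)) ℚ) :
    Polynomial.derivative (toPoly l p) = toPoly l (pderiv (Fin.natAdd l 0) p) := by
  induction p using MvPolynomial.induction_on with
  | C a =>
    have : toPoly l (C a) = Polynomial.C (C a) := by
      have := toPoly_inclFst (l := l) (C a)
      rwa [inclFst, algHom_C] at this
    rw [this, pderiv_C, map_zero, Polynomial.derivative_C]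
  | add p q hp hq => rw [map_add, map_add, map_add, map_add, hp, hq]
  | mul_X p i hp =>
    have hX : Polynomial.derivative (toPoly l (X i)) = toPoly l (pderiv (Fin.natAdd l 0) (X i)) := by
      induction i using Fin.addCases with
      | left i =>
        rw [toPoly_X_castAdd, Polynomial.derivative_C, pderiv_X_of_ne, map_zero]
        exact Fin.ne_of_val_ne (by simp; omega)
      | right j =>
        rw [Subsingleton.elim j 0, toPoly_X_natAdd, Polynomial.derivative_X, pderiv_X_self, map_one]
    rw [map_mul, Polynomial.derivative_mul, hp, hX, pderiv_mul, map_add, map_mul, map_mul]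

theorem toPoly_monomial {l : ℕ} (d : Fin (l + 1) →₀ ℕ) (r : ℚ) :
    toPoly l (monomial d r) = Polynomial.monomial (d (Fin.natAdd l 0))
      (monomial (d.comapDomain (Fin.castAdd 1) (Fin.castAdd_injective l 1).injOn) r) := by
  have h1 : ∀ {σ : Type} [Fintype σ] (e : σ →₀ ℕ), monomial e r = C r * ∏ i, X i ^ e i := by
    intro σ _ e
    rw [monomial_eq, Finsupp.prod_fintype _ _ (by simp)]
  rw [h1, h1, ← Polynomial.C_mul_X_pow_eq_monomial, map_mul, map_prod, Fin.prod_univ_castSucc,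
    Polynomial.C_mul, map_prod, mul_assoc]
  have h2 : toPoly l (C r) = Polynomial.C (C r) := by
    have := toPoly_inclFst (l := l) (C r)
    rwa [inclFst, algHom_C] at this
  rw [h2]
  congr 2
  · refine Finset.prod_congr rfl fun i _ => ?_
    rw [map_pow, map_pow]
    congr 1
    exact toPoly_X_castAdd i
  · rw [map_pow]
    congr 1
    exact toPoly_X_natAdd 0

theorem homogeneous_coeff_toPoly {l : ℕ} {w : Fin (l + 1) → ℕ} {p : MvPolynomial (Fin (l + 1)) ℚ}
    {m : ℕ} (hp : IsWeightedHomogeneous w p m) {n e : ℕ} (he : e + n * w (Fin.natAdd l 0) = m) :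
    IsWeightedHomogeneous (fun i => w (Fin.castAdd 1 i)) ((toPoly l p).coeff n) e := by
  rw [p.as_sum, map_sum, Polynomial.finsetSum_coeff]
  refine IsWeightedHomogeneous.sum _ _ _ fun d hd => ?_
  rw [toPoly_monomial, Polynomial.coeff_monomial]
  split_ifs with hn
  · refine isWeightedHomogeneous_monomial _ _ _ ?_
    have h1 := hp (mem_support_iff.1 hd)
    rw [weight_eq_sum, Fin.sum_univ_castSucc] at h1
    rw [weight_eq_sum]
    have h2 : d (Fin.natAdd l 0) * w (Fin.natAdd l 0) = n * w (Fin.natAdd l 0) := by rw [hn]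
    have h3 : d (Fin.last l) * w (Fin.last l) = d (Fin.natAdd l 0) * w (Fin.natAdd l 0) := rfl
    have h4 : ∑ i, (d.comapDomain (Fin.castAdd 1) (Fin.castAdd_injective l 1).injOn) i *
        w (Fin.castAdd 1 i) = ∑ i : Fin l, d i.castSucc * w i.castSucc := rfl
    omega
  · exact isWeightedHomogeneous_zero ℚ _ _

theorem coeff_toPoly_eq_zero {l : ℕ} {w : Fin (l + 1) → ℕ} {p : MvPolynomial (Fin (l + 1)) ℚ}
    {m : ℕ} (hp : IsWeightedHomogeneous w p m) {n : ℕ} (hn : m < n * w (Fin.natAdd l 0)) :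
    (toPoly l p).coeff n = 0 := by
  rw [p.as_sum, map_sum, Polynomial.finsetSum_coeff]
  refine Finset.sum_eq_zero fun d hd => ?_
  rw [toPoly_monomial, Polynomial.coeff_monomial]
  split_ifs with h
  · by_cases h0 : d (Fin.natAdd l 0) = 0
    · rw [← h, h0] at hn; omega
    · have h1 := hp (mem_support_iff.1 hd)
      rw [weight_eq_sum] at h1
      have h2 := Finset.single_le_sum (f := fun i => d i * w i) (fun _ _ => Nat.zero_le _)
        (Finset.mem_univ (Fin.natAdd l 0))
      simp only [h, h1] at h2
      omega
  · rfl

theorem isUnit_of_homogeneous {σ : Type*} {w : σ → ℕ} (hw : ∀ i, w i ≠ 0) {p : MvPolynomial σ ℚ}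
    {e : ℕ} (hp : IsWeightedHomogeneous w p e) (h0 : constantCoeff p ≠ 0) : IsUnit p := by
  have he : e = 0 := by
    have := hp (d := 0) h0
    rw [map_zero] at this
    exact this.symm
  classical
  have : p = C (constantCoeff p) := by
    ext d
    rw [coeff_C]
    split_ifs with hd
    · rw [← hd]; rfl
    · by_contra hne
      have h1 := hp hne
      rw [he] at h1
      refine hd (Finsupp.ext fun i => ?_)
      have h2 := Finsupp.le_weight w (hw i) d
      rw [h1] at h2
      exact (Nat.le_zero.1 h2).symm
  rw [this]
  exact (IsUnit.mk0 _ h0).map C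

end PositivelyElliptic

namespace PositivelyElliptic

theorem constantCoeff_coeff_toPoly {l : ℕ} (p : MvPolynomial (Fin (l + 1)) ℚ) :
    constantCoeff ((toPoly l p).coeff 0) = constantCoeff p := by
  have : (constantCoeff.comp Polynomial.constantCoeff).comp (toPoly l).toRingEquiv.toRingHom =
      (constantCoeff : MvPolynomial (Fin (l + 1)) ℚ →+* ℚ) := by
    apply MvPolynomial.ringHom_ext'
    · exact RingHom.ext_rat _ _
    · intro i
      induction i using Fin.addCases with
      | left i =>
        show constantCoeff ((toPoly l (X (Fin.castAdd 1 i))).coeff 0) = _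
        rw [toPoly_X_castAdd]
        simp
      | right j =>
        show constantCoeff ((toPoly l (X (Fin.natAdd l j))).coeff 0) = _
        rw [toPoly_X_natAdd]
        simp
  exact RingHom.congr_fun this p

/-- Here the derivation is q ∂_2, where q is free of x_2 because its degree is below w 2. The
divisibility lemma over ℚ[x_0, x_1] gives q ∈ (u_0, r), where r is the part of u_1 free of x_2.
Since r has degree b 1 ≥ w 2, larger than the degree of q, only u_0 contributes. -/
theorem last_mem_of_mkDerivation_mem {w : Fin (2 + 1) → ℕ} (hw : ∀ i, w i ≠ 0)
    {u : Fin 3 → MvPolynomial (Fin (2 + 1)) ℚ} {b : Fin 3 → ℕ} (hb : Monotone b)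
    (hu : ∀ i, IsWeightedHomogeneous w (u i) (b i)) (hreg : RegularFamily u)
    (h0 : ∀ i, constantCoeff (u i) = 0)
    (hnil : ∃ n, (X 2 : MvPolynomial (Fin (2 + 1)) ℚ) ^ n ∈ Ideal.span (Set.range u))
    {p : Fin (2 + 1) → MvPolynomial (Fin (2 + 1)) ℚ} {t : ℕ} (ht : 0 < t)
    (hp : ∀ i, p i ≠ 0 → ∃ e, e + t = w i ∧ IsWeightedHomogeneous w (p i) e)
    (hp0 : p 0 = 0) (hp1 : p 1 = 0) (hwb : w 2 ≤ b 1)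
    (hfree : ∀ d ∈ (u 0).support, d 2 = 0) (hu0 : u 0 ≠ 0)
    (hD : ∀ i, mkDerivation ℚ p (u i) ∈ Ideal.span (Set.range u)) :
    p 2 ∈ Ideal.span (Set.range u) := by
  by_cases hq0 : p 2 = 0
  · rw [hq0]; exact zero_mem _
  obtain ⟨e, he, hq⟩ := hp 2 hq0
  have hDf : ∀ f, mkDerivation ℚ p f = p 2 * pderiv 2 f := by
    intro f
    rw [mkDerivation_eq_sum, Fin.sum_univ_three, hp0, hp1, zero_mul, zero_mul, zero_add, zero_add]
  have hb01 : b 0 ≤ b 1 := hb (by decide)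
  have hb12 : b 1 ≤ b 2 := hb (by decide)
  have hlast : ∀ j : Fin 1, Fin.natAdd 2 j = 2 := by decide
  -- the derivatives of the relations
  obtain ⟨c, hc, hc0⟩ := mkDerivation_rel_eq_zero hu ht hp (hD 1)
  rw [Fin.sum_univ_three, hc0 1 le_rfl, hc0 2 hb12, zero_mul, zero_mul, add_zero, add_zero, hDf] at hc
  obtain ⟨c', hc', hc0'⟩ := mkDerivation_rel_eq_zero hu ht hp (hD 2)
  rw [Fin.sum_univ_three, hc0' 2 le_rfl, zero_mul, add_zero, hDf] at hc'
  have hinc0 : inclFst 2 1 (projFst 2 1 (u 0)) = u 0 :=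
    inclFst_projFst fun d hd j => by rw [hlast]; exact hfree d hd
  have hincq : inclFst 2 1 (projFst 2 1 (p 2)) = p 2 :=
    inclFst_projFst fun d hd j => by
      rw [hlast]
      by_contra hne
      have := weight_le_of_mem_support hq hd hne
      omega
  set s := projFst 2 1 (u 0) with hs
  set q := projFst 2 1 (p 2) with hqdef
  have hTs : toPoly 2 (u 0) = Polynomial.C s := by rw [← hinc0, toPoly_inclFst]
  have hTq : toPoly 2 (p 2) = Polynomial.C q := by rw [← hincq, toPoly_inclFst]
  have hder : ∀ f, Polynomial.C q * Polynomial.derivative (toPoly 2 f) =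
      toPoly 2 (p 2 * pderiv 2 f) := by
    intro f
    rw [derivative_toPoly, map_mul, hTq]
    rfl
  have hregdvd : ∀ g, Polynomial.C s ∣ toPoly 2 (u 1) * g → Polynomial.C s ∣ g := by
    intro g hg
    obtain ⟨g, rfl⟩ := (toPoly 2).surjective g
    rw [← hTs, ← map_mul, map_dvd_iff] at hg
    rw [← hTs, map_dvd_iff]
    have hIio : Set.Iio (1 : Fin 3) = {0} := by
      ext i
      fin_cases i <;> simp
    have := hreg 1 g
    rw [hIio, Set.image_singleton, Ideal.mem_span_singleton, Ideal.mem_span_singleton] at this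
    exact this hg
  -- a pure power of the last variable occurs in the second or third relation
  obtain ⟨n, hn, hunit⟩ : ∃ n, n ≠ 0 ∧ (IsUnit ((toPoly 2 (u 1)).coeff n) ∨
      IsUnit ((toPoly 2 (u 2)).coeff n)) := by
    have hkey : ∀ i n, constantCoeff ((toPoly 2 (u i)).coeff n) ≠ 0 →
        n ≠ 0 ∧ IsUnit ((toPoly 2 (u i)).coeff n) := by
      intro i n hne
      refine ⟨?_, ?_⟩
      · rintro rfl
        rw [constantCoeff_coeff_toPoly] at hne
        exact hne (h0 i)
      · by_cases hlt : b i < n * w (Fin.natAdd 2 0)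
        · rw [coeff_toPoly_eq_zero (hu i) hlt, map_zero] at hne
          exact absurd rfl hne
        · exact isUnit_of_homogeneous (fun j => hw (Fin.castAdd 1 j))
            (homogeneous_coeff_toPoly (hu i) (Nat.sub_add_cancel (not_lt.1 hlt))) hne
    -- This sets x_0 and x_1 to zero. If no relation contained a pure power of x_2, it would kill
    -- the whole ideal, which contains a power of x_2.
    let ρ : MvPolynomial (Fin (2 + 1)) ℚ →+* Polynomial ℚ :=
      (Polynomial.mapRingHom constantCoeff).comp (toPoly 2).toRingEquiv.toRingHom
    have hρ : ∀ f n, (ρ f).coeff n = constantCoeff ((toPoly 2 f).coeff n) := fun f n =>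
      Polynomial.coeff_map _ _
    by_contra! hcon
    have hker : Ideal.span (Set.range u) ≤ RingHom.ker ρ := by
      rw [Ideal.span_le]
      rintro _ ⟨i, rfl⟩
      refine RingHom.mem_ker.2 (Polynomial.ext fun n => ?_)
      rw [hρ, Polynomial.coeff_zero]
      by_contra hne
      obtain ⟨hn0, hun⟩ := hkey i n hne
      fin_cases i
      · refine hne ?_
        show constantCoeff ((toPoly 2 (u 0)).coeff n) = 0
        rw [hTs, Polynomial.coeff_C, if_neg hn0, map_zero]
      · exact (hcon n hn0).1 hun
      · exact (hcon n hn0).2 hun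
    obtain ⟨N, hN⟩ := hnil
    have h1 := RingHom.mem_ker.1 (hker hN)
    have h2 : ρ (X 2) = Polynomial.X := by
      show Polynomial.map _ (toPoly 2 (X (Fin.natAdd 2 0))) = _
      rw [toPoly_X_natAdd, Polynomial.map_X]
    rw [map_pow, h2] at h1
    exact pow_ne_zero N Polynomial.X_ne_zero h1
  have hs0 : s ≠ 0 := by
    intro h
    rw [h, map_zero] at hinc0
    exact hu0 hinc0.symm
  have hmem := mem_span_pair_of_derivative hs0 hregdvd
    (hu := ⟨toPoly 2 (c 0), by rw [hder, hc, map_mul, hTs, mul_comm]⟩)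
    (f := toPoly 2 (c' 0)) (g := toPoly 2 (c' 1))
    (v := toPoly 2 (u 2)) (by rw [hder, hc', map_add, map_mul, map_mul, hTs]) hn hunit
  -- compare degrees
  set w' : Fin 2 → ℕ := fun i => w (Fin.castAdd 1 i) with hw'
  have hproj : ∀ i, IsWeightedHomogeneous w' (Fin.addCases (motive := fun _ => MvPolynomial (Fin 2) ℚ)
      X (fun _ : Fin 1 => 0) i) (w i) := by
    intro i
    induction i using Fin.addCases with
    | left i => simpa using isWeightedHomogeneous_X ℚ w' i
    | right j => simpa using isWeightedHomogeneous_zero ℚ _ _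
  have hsh : IsWeightedHomogeneous w' s (b 0) := isWeightedHomogeneous_aeval hproj (hu 0)
  have hqh : IsWeightedHomogeneous w' q e := isWeightedHomogeneous_aeval hproj hq
  have hrh : IsWeightedHomogeneous w' ((toPoly 2 (u 1)).coeff 0) (b 1) :=
    homogeneous_coeff_toPoly (hu 1) (by simp)
  obtain ⟨x, y, hxy⟩ := Ideal.mem_span_pair.1 hmem
  have hcomp := congrArg (weightedHomogeneousComponent w' e) hxy
  have hlt : ¬ b 1 ≤ e := by omega
  rw [hqh.weightedHomogeneousComponent_same, map_add, mul_comm x, mul_comm y,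
    component_mul_of_homogeneous hsh, component_mul_of_homogeneous hrh, if_neg hlt,
    add_zero] at hcomp
  have hdvd : s ∣ q := by
    rw [← hcomp]
    split_ifs
    · exact dvd_mul_right _ _
    · exact dvd_zero _
  have := map_dvd (inclFst 2 1) hdvd
  rw [hinc0, hincq] at this
  exact Ideal.mem_of_dvd _ this (Ideal.subset_span (Set.mem_range_self 0))

end PositivelyElliptic

/-! ### Linear change of two generators of equal degree -/

namespace PositivelyElliptic

/-- Two linear substitutions of the last two of three variables, inverse to each other. -/
theorem exists_linear_equiv {c c' : ℚ} (hc : c ≠ 0 ∨ c' ≠ 0) {w : Fin (2 + 1) → ℕ} (hw : w 1 = w 2) :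
    ∃ φ ψ : MvPolynomial (Fin (2 + 1)) ℚ →ₐ[ℚ] MvPolynomial (Fin (2 + 1)) ℚ,
      (∀ f, φ (ψ f) = f) ∧ (∀ f, ψ (φ f) = f) ∧
      (∀ i, IsWeightedHomogeneous w (φ (X i)) (w i)) ∧
      (∀ i, IsWeightedHomogeneous w (ψ (X i)) (w i)) ∧
      (∀ i, constantCoeff (φ (X i)) = 0) ∧
      ψ (X 0) = X 0 ∧ ψ (X 1) = C c' * X 1 - C c * X 2 ∧ ψ (X 2) = C c * X 1 + C c' * X 2 := by
  -- The substitution ψ is a rotation up to scaling, with determinant c² + c'². Over ℚ this is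
  -- non-zero for every (c, c') ≠ 0, so no case distinction is needed.
  have hΔ : c ^ 2 + c' ^ 2 ≠ 0 := by
    rcases hc with h | h <;> positivity
  set Δ := c ^ 2 + c' ^ 2 with hΔd
  let a : Fin (2 + 1) → MvPolynomial (Fin (2 + 1)) ℚ :=
    ![X 0, C (c' / Δ) * X 1 + C (c / Δ) * X 2, C (-c / Δ) * X 1 + C (c' / Δ) * X 2]
  let b : Fin (2 + 1) → MvPolynomial (Fin (2 + 1)) ℚ :=
    ![X 0, C c' * X 1 - C c * X 2, C c * X 1 + C c' * X 2]
  have h11 : c' * (c' / Δ) + c * (c / Δ) = 1 := by field_simp; rw [hΔd]; ring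
  have ha0 : aeval (R := ℚ) a (X 0) = X 0 := by rw [aeval_X]; rfl
  have ha1 : aeval (R := ℚ) a (X 1) = C (c' / Δ) * X 1 + C (c / Δ) * X 2 := by rw [aeval_X]; rfl
  have ha2 : aeval (R := ℚ) a (X 2) = C (-c / Δ) * X 1 + C (c' / Δ) * X 2 := by rw [aeval_X]; rfl
  have hb0 : aeval (R := ℚ) b (X 0) = X 0 := by rw [aeval_X]; rfl
  have hb1 : aeval (R := ℚ) b (X 1) = C c' * X 1 - C c * X 2 := by rw [aeval_X]; rfl
  have hb2 : aeval (R := ℚ) b (X 2) = C c * X 1 + C c' * X 2 := by rw [aeval_X]; rfl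
  have hneg : (C (-c / Δ) : MvPolynomial (Fin (2 + 1)) ℚ) = - C (c / Δ) := by
    rw [← map_neg, neg_div]
  have hC : (C c' * C (c' / Δ) + C c * C (c / Δ) : MvPolynomial (Fin (2 + 1)) ℚ) = 1 := by
    rw [← map_mul, ← map_mul, ← map_add, h11, map_one]
  have hC' : (C c * C (c' / Δ) : MvPolynomial (Fin (2 + 1)) ℚ) = C c' * C (c / Δ) := by
    rw [← map_mul, ← map_mul]; congr 1; ring
  have aC : ∀ r, aeval a (C r) = C r := fun r => (aeval a).commutes r
  have bC : ∀ r, aeval b (C r) = C r := fun r => (aeval b).commutes r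
  have hab : (aeval a).comp (aeval b) = AlgHom.id ℚ (MvPolynomial (Fin (2 + 1)) ℚ) := by
    apply algHom_ext
    intro i
    fin_cases i
    · show aeval a (aeval b (X 0)) = X 0
      rw [hb0, ha0]
    · show aeval a (aeval b (X 1)) = X 1
      rw [hb1, map_sub, map_mul, map_mul, aC, aC, ha1, ha2, hneg]
      linear_combination X 1 * hC - X 2 * hC'
    · show aeval a (aeval b (X 2)) = X 2
      rw [hb2, map_add, map_mul, map_mul, aC, aC, ha1, ha2, hneg]
      linear_combination X 2 * hC + X 1 * hC'
  have hba : (aeval b).comp (aeval a) = AlgHom.id ℚ (MvPolynomial (Fin (2 + 1)) ℚ) := by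
    apply algHom_ext
    intro i
    fin_cases i
    · show aeval b (aeval a (X 0)) = X 0
      rw [ha0, hb0]
    · show aeval b (aeval a (X 1)) = X 1
      rw [ha1, map_add, map_mul, map_mul, bC, bC, hb1, hb2]
      linear_combination X 1 * hC - X 2 * hC'
    · show aeval b (aeval a (X 2)) = X 2
      rw [ha2, map_add, map_mul, map_mul, bC, bC, hb1, hb2, hneg]
      linear_combination X 2 * hC + X 1 * hC'
  have hX1 : ∀ r : ℚ, IsWeightedHomogeneous w (C r * X 1) (w 1) := fun r =>
    (isWeightedHomogeneous_X ℚ w 1).C_mul r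
  have hX2 : ∀ r : ℚ, IsWeightedHomogeneous w (C r * X 2) (w 1) := fun r => by
    rw [hw]; exact (isWeightedHomogeneous_X ℚ w 2).C_mul r
  have hsub : (C c' * X 1 - C c * X 2 : MvPolynomial (Fin (2 + 1)) ℚ) =
      C c' * X 1 + C (-c) * X 2 := by rw [map_neg]; ring
  refine ⟨aeval a, aeval b, AlgHom.congr_fun hab, AlgHom.congr_fun hba, ?_, ?_, ?_, hb0, hb1, hb2⟩
  · intro i
    fin_cases i
    · show IsWeightedHomogeneous w (aeval a (X 0)) (w 0)
      rw [ha0]; exact isWeightedHomogeneous_X ℚ w 0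
    · show IsWeightedHomogeneous w (aeval a (X 1)) (w 1)
      rw [ha1]; exact (hX1 _).add (hX2 _)
    · show IsWeightedHomogeneous w (aeval a (X 2)) (w 2)
      rw [ha2, ← hw]; exact (hX1 _).add (hX2 _)
  · intro i
    fin_cases i
    · show IsWeightedHomogeneous w (aeval b (X 0)) (w 0)
      rw [hb0]; exact isWeightedHomogeneous_X ℚ w 0
    · show IsWeightedHomogeneous w (aeval b (X 1)) (w 1)
      rw [hb1, hsub]; exact (hX1 _).add (hX2 _)
    · show IsWeightedHomogeneous w (aeval b (X 2)) (w 2)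
      rw [hb2, ← hw]; exact (hX1 _).add (hX2 _)
  · intro i
    fin_cases i
    · show constantCoeff (aeval a (X 0)) = 0
      rw [ha0]; simp
    · show constantCoeff (aeval a (X 1)) = 0
      rw [ha1]; simp
    · show constantCoeff (aeval a (X 2)) = 0
      rw [ha2]; simp

/-- The derivation M (c ∂_1 + c' ∂_2) kills c' x_1 - c x_2 and maps c x_1 + c' x_2 to (c² + c'²) M.
Conjugating by the linear change therefore gives a derivation along the last variable alone, and it
kills the transformed u_0 for degree reasons. -/
theorem mem_of_mkDerivation_mem {w : Fin (2 + 1) → ℕ} (hw : ∀ i, w i ≠ 0) (hw12 : w 1 = w 2)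
    {u : Fin 3 → MvPolynomial (Fin (2 + 1)) ℚ} {b : Fin 3 → ℕ} (hb : Monotone b)
    (hu : ∀ i, IsWeightedHomogeneous w (u i) (b i)) (hreg : RegularFamily u)
    (h0 : ∀ i, constantCoeff (u i) = 0)
    (hnil : ∃ B, ∀ n, B < n → ∀ f, IsWeightedHomogeneous w f n → f ∈ Ideal.span (Set.range u))
    {p : Fin (2 + 1) → MvPolynomial (Fin (2 + 1)) ℚ} {M : MvPolynomial (Fin (2 + 1)) ℚ}
    {c c' : ℚ} {e t : ℕ} (ht : 0 < t) (he : e + t = w 2) (hM : IsWeightedHomogeneous w M e)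
    (hp0 : p 0 = 0) (hp1 : p 1 = C c * M) (hp2 : p 2 = C c' * M) (hc : c ≠ 0 ∨ c' ≠ 0)
    (hwb : w 2 ≤ b 1) (hu0 : u 0 ≠ 0)
    (hD : ∀ i, mkDerivation ℚ p (u i) ∈ Ideal.span (Set.range u)) :
    M ∈ Ideal.span (Set.range u) := by
  by_cases hM0 : M = 0
  · rw [hM0]; exact zero_mem _
  have hp : ∀ i, p i ≠ 0 → ∃ e, e + t = w i ∧ IsWeightedHomogeneous w (p i) e := by
    intro i hi
    fin_cases i
    · exact absurd hp0 hi
    · refine ⟨e, he.trans hw12.symm, ?_⟩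
      show IsWeightedHomogeneous w (p 1) e
      rw [hp1]; exact hM.C_mul c
    · refine ⟨e, he, ?_⟩
      show IsWeightedHomogeneous w (p 2) e
      rw [hp2]; exact hM.C_mul c'
  obtain ⟨φ, ψ, hφψ, hψφ, hφh, hψh, hφ0, hψ0, hψ1, hψ2⟩ := exists_linear_equiv hc hw12
  have hΔ : c ^ 2 + c' ^ 2 ≠ 0 := by
    rcases hc with h | h <;> positivity
  have hφh' : ∀ {f n}, IsWeightedHomogeneous w f n → IsWeightedHomogeneous w (φ f) n := by
    intro f n hf
    rw [aeval_unique φ]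
    exact isWeightedHomogeneous_aeval hφh hf
  have hψh' : ∀ {f n}, IsWeightedHomogeneous w f n → IsWeightedHomogeneous w (ψ f) n := by
    intro f n hf
    rw [aeval_unique ψ]
    exact isWeightedHomogeneous_aeval hψh hf
  have hmem : ∀ s f, φ f ∈ Ideal.span ((fun i => φ (u i)) '' s) ↔ f ∈ Ideal.span (u '' s) := by
    intro s f
    have hker : RingHom.ker φ = ⊥ := (RingHom.injective_iff_ker_eq_bot φ).1
      (Function.LeftInverse.injective hψφ)
    rw [mem_span_image_iff_of_surjective φ (Function.RightInverse.surjective hφψ) u s f, hker, sup_bot_eq]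
  have hmem' : ∀ f, φ f ∈ Ideal.span (Set.range fun i => φ (u i)) ↔ f ∈ Ideal.span (Set.range u) := by
    intro f
    rw [← Set.image_univ, ← Set.image_univ]
    exact hmem Set.univ f
  set p' : Fin (2 + 1) → MvPolynomial (Fin (2 + 1)) ℚ := fun i => φ (mkDerivation ℚ p (ψ (X i)))
    with hp'
  have hp'0 : p' 0 = 0 := by
    show φ (mkDerivation ℚ p (ψ (X 0))) = 0
    rw [hψ0, mkDerivation_X, hp0, map_zero]
  have hDC : ∀ r f, mkDerivation ℚ p (C r * f) = C r * mkDerivation ℚ p f := by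
    intro r f
    rw [C_mul', C_mul', Derivation.map_smul]
  have hp'1 : p' 1 = 0 := by
    show φ (mkDerivation ℚ p (ψ (X 1))) = 0
    rw [hψ1, map_sub, hDC, hDC, mkDerivation_X, mkDerivation_X, hp1, hp2,
      show C c' * (C c * M) - C c * (C c' * M) = 0 by ring, map_zero]
  have hp'2 : p' 2 = φ (C (c ^ 2 + c' ^ 2) * M) := by
    show φ (mkDerivation ℚ p (ψ (X 2))) = _
    rw [hψ2, map_add, hDC, hDC, mkDerivation_X, mkDerivation_X, hp1, hp2, map_add C, map_pow, map_pow]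
    congr 1
    ring
  have hD' : ∀ f, mkDerivation ℚ p' (φ f) = φ (mkDerivation ℚ p f) := by
    have key : ∀ g, mkDerivation ℚ p' g = φ (mkDerivation ℚ p (ψ g)) := by
      intro g
      induction g using MvPolynomial.induction_on with
      | C r =>
        have : ψ (C r) = C r := ψ.commutes r
        rw [this, derivation_C, derivation_C, map_zero]
      | add f g hf hg => simp only [map_add, hf, hg]
      | mul_X f i hf =>
        rw [Derivation.leibniz, mkDerivation_X, map_mul, Derivation.leibniz, map_add, smul_eq_mul,
          smul_eq_mul, smul_eq_mul, smul_eq_mul, map_mul, map_mul, hφψ, hφψ, hf]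
    intro f
    rw [key, hψφ]
  have hp'h : ∀ i, p' i ≠ 0 → ∃ e, e + t = w i ∧ IsWeightedHomogeneous w (p' i) e := by
    intro i hi
    fin_cases i
    · exact absurd hp'0 hi
    · exact absurd hp'1 hi
    · refine ⟨e, he, ?_⟩
      show IsWeightedHomogeneous w (p' 2) e
      rw [hp'2]
      exact hφh' (hM.C_mul _)
  have hu' : ∀ i, IsWeightedHomogeneous w (φ (u i)) (b i) := fun i => hφh' (hu i)
  have hDm : ∀ i, mkDerivation ℚ p' (φ (u i)) ∈ Ideal.span (Set.range fun i => φ (u i)) := by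
    intro i
    rw [hD', hmem']
    exact hD i
  have hfree : ∀ d ∈ (φ (u 0)).support, d 2 = 0 := by
    intro d hd
    obtain ⟨c0, hc0, hc00⟩ := mkDerivation_rel_eq_zero hu' ht hp'h (hDm 0)
    rw [Finset.sum_eq_zero fun j _ => by rw [hc00 j (hb (Fin.zero_le j)), zero_mul],
      mkDerivation_eq_sum, Fin.sum_univ_three, hp'0, hp'1, zero_mul, zero_mul, zero_add,
      zero_add] at hc0
    refine eq_zero_of_pderiv_eq_zero ((mul_eq_zero.1 hc0).resolve_left ?_) hd
    rw [hp'2, map_eq_zero_iff φ (Function.LeftInverse.injective hψφ)]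
    exact mul_ne_zero (by rwa [Ne, C_eq_zero]) hM0
  have hreg' : RegularFamily fun i => φ (u i) := by
    intro i f hf
    obtain ⟨f, rfl⟩ := Function.RightInverse.surjective hφψ f
    simp only [← map_mul] at hf
    rw [hmem] at hf ⊢
    exact hreg i f hf
  have h0' : ∀ i, constantCoeff (φ (u i)) = 0 := by
    intro i
    rw [← mem_idealOfVars_iff, aeval_unique φ, ← pow_one (idealOfVars _ _)]
    exact aeval_mem_pow_idealOfVars (fun j => mem_idealOfVars_iff.2 (hφ0 j))
      (by rw [pow_one]; exact mem_idealOfVars_iff.2 (h0 i))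
  have hnil' : ∃ n, (X 2 : MvPolynomial (Fin (2 + 1)) ℚ) ^ n ∈
      Ideal.span (Set.range fun i => φ (u i)) := by
    obtain ⟨B, hB⟩ := hnil
    refine ⟨B + 1, ?_⟩
    rw [← hφψ (X 2 ^ (B + 1)), hmem']
    refine hB ((B + 1) * w 2) ?_ _ (hψh' ?_)
    · exact Nat.lt_of_lt_of_le (Nat.lt_succ_self B)
        (Nat.le_mul_of_pos_right _ (Nat.pos_of_ne_zero (hw 2)))
    · simpa using (isWeightedHomogeneous_X ℚ w 2).pow (B + 1)
  have hlast := last_mem_of_mkDerivation_mem hw hb hu' hreg' h0' hnil' ht hp'h hp'0 hp'1 hwb hfree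
    (by rwa [Ne, map_eq_zero_iff φ (Function.LeftInverse.injective hψφ)]) hDm
  rw [hp'2, hmem'] at hlast
  have := Ideal.mul_mem_left _ (C (c ^ 2 + c' ^ 2)⁻¹) hlast
  rwa [← mul_assoc, ← map_mul, inv_mul_cancel₀ hΔ, map_one, one_mul] at this

end PositivelyElliptic

/-! ### No negative derivations for two or three generators -/

namespace PositivelyElliptic

theorem exists_eq_C_mul_X_pow {w : Fin (2 + 1) → ℕ} (hw : w 0 ≠ 0) {e : ℕ} (h1 : e < w 1)
    (h2 : e < w 2) {f : MvPolynomial (Fin (2 + 1)) ℚ} (hf : IsWeightedHomogeneous w f e) :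
    ∃ c, f = C c * X 0 ^ (e / w 0) := by
  -- If `w 0` does not divide `e`, the rounded exponent does no harm: the monomial has the wrong
  -- degree, so its coefficient is 0, and so is f.
  refine ⟨coeff (Finsupp.single 0 (e / w 0)) f, ?_⟩
  rw [C_mul_X_pow_eq_monomial]
  ext d
  rw [coeff_monomial]
  split_ifs with hd
  · rw [hd]
  · by_contra hne
    have hs := mem_support_iff.2 hne
    have hd1 : d 1 = 0 := by
      by_contra h
      have := weight_le_of_mem_support hf hs h
      omega
    have hd2 : d 2 = 0 := by
      by_contra h
      have := weight_le_of_mem_support hf hs h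
      omega
    have hd0 := hf hne
    rw [weight_eq_sum, Fin.sum_univ_three, hd1, hd2] at hd0
    have hd0' : d 0 = e / w 0 := by
      rw [← hd0, zero_mul, zero_mul, add_zero, add_zero, Nat.mul_div_cancel _ (Nat.pos_of_ne_zero hw)]
    refine hd (Finsupp.ext fun i => ?_)
    fin_cases i
    · simp [hd0']
    · simpa using hd1.symm
    · simpa using hd2.symm

section

variable {k : ℕ} {H : PositivelyElliptic k}

/-- The polynomial would have positive degree smaller than that of every generator. -/
theorem IsPureModel.lift_zero_eq_zero (hH : H.IsPureModel) (hk : 0 < k) {t : ℕ} (ht : 0 < t)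
    {p : Fin k → MvPolynomial (Fin k) ℚ}
    (hp : ∀ i, p i ≠ 0 → ∃ e, e + t = H.deg i ∧ 0 < e ∧ IsWeightedHomogeneous H.deg (p i) e) :
    p ⟨0, hk⟩ = 0 := by
  by_contra h
  obtain ⟨e, he, he0, hhom⟩ := hp _ h
  refine h (eq_zero_of_homogeneous_lt hhom he0 fun i => ?_)
  have : H.deg ⟨0, hk⟩ ≤ H.deg i := hH.deg_mono (Fin.mk_le_of_le_val (Nat.zero_le _))
  omega

theorem IsPureModel.mkDerivation_rel_zero (hH : H.IsPureModel) (hk : 0 < k) {t : ℕ} (ht : 0 < t)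
    {p : Fin k → MvPolynomial (Fin k) ℚ}
    (hp : ∀ i, p i ≠ 0 → ∃ e, e + t = H.deg i ∧ IsWeightedHomogeneous H.deg (p i) e)
    (h : mkDerivation ℚ p (H.rel ⟨0, hk⟩) ∈ H.relIdeal) : mkDerivation ℚ p (H.rel ⟨0, hk⟩) = 0 := by
  obtain ⟨c, hc, hc0⟩ := mkDerivation_rel_eq_zero H.rel_homogeneous ht hp h
  rw [hc]
  refine Finset.sum_eq_zero fun j _ => ?_
  rw [hc0 j (hH.relDeg_mono (Fin.mk_le_of_le_val (Nat.zero_le _))), zero_mul]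

end

theorem not_hasNegativeDerivation_two {H : PositivelyElliptic 2} (hH : H.IsPureModel)
    (hs : ¬ H.Splits) : ¬ H.HasNegativeDerivation := by
  rintro ⟨t, ht, δ, hδ, hδ0⟩
  obtain ⟨p, hp, hpδ⟩ := exists_lift hH.constantCoeff_rel hδ
  have hp' : ∀ i, p i ≠ 0 → ∃ e, e + t = H.deg i ∧ IsWeightedHomogeneous H.deg (p i) e :=
    fun i hi => let ⟨e, he, _, h⟩ := hp i hi; ⟨e, he, h⟩
  have hp0 : p 0 = 0 := hH.lift_zero_eq_zero two_pos ht hp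
  have hD : mkDerivation ℚ p (H.rel 0) = 0 :=
    hH.mkDerivation_rel_zero two_pos ht hp' (mkDerivation_rel_mem hpδ _)
  rw [mkDerivation_eq_sum, Fin.sum_univ_two, hp0, zero_mul, zero_add] at hD
  rcases mul_eq_zero.1 hD with hp1 | h
  · refine hδ0 (eq_zero_of_lift hpδ fun i => ?_)
    fin_cases i
    · show p 0 ∈ _; rw [hp0]; exact zero_mem _
    · show p 1 ∈ _; rw [hp1]; exact zero_mem _
  · refine hs (splits_of_support (l := 1) (n := 1) (H := H) hH one_pos one_pos fun i d hd j => ?_)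
    fin_cases i
    fin_cases j
    exact eq_zero_of_pderiv_eq_zero h hd

theorem not_hasNegativeDerivation_three {H : PositivelyElliptic 3} (hH : H.IsPureModel)
    (hs : ¬ H.Splits) {N : ℕ} (hfd : H.IsFormalDimension N) (hN : N ≤ 20)
    (hdeg : 12 ≤ H.deg 1 + H.deg 2) : ¬ H.HasNegativeDerivation := by
  rintro ⟨t, ht, δ, hδ, hδ0⟩
  obtain ⟨p, hp, hpδ⟩ := exists_lift hH.constantCoeff_rel hδ
  have hp' : ∀ i, p i ≠ 0 → ∃ e, e + t = H.deg i ∧ IsWeightedHomogeneous H.deg (p i) e :=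
    fun i hi => let ⟨e, he, _, h⟩ := hp i hi; ⟨e, he, h⟩
  have hp0 : p 0 = 0 := hH.lift_zero_eq_zero three_pos ht hp
  have hD : ∀ i, mkDerivation ℚ p (H.rel i) ∈ H.relIdeal := mkDerivation_rel_mem hpδ
  have hD0 : mkDerivation ℚ p (H.rel 0) = 0 := hH.mkDerivation_rel_zero three_pos ht hp' (hD _)
  have hsum := hH.formalDimension hfd
  rw [Fin.sum_univ_three, Fin.sum_univ_three] at hsum
  have hb0 : H.deg 0 + H.deg 1 ≤ H.relDeg 0 := hH.deg_add_deg_le hs (l := 0) (by norm_num)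
  have hb1 : H.deg 0 + H.deg 2 ≤ H.relDeg 1 := hH.deg_add_deg_le hs (l := 1) (by norm_num)
  have hb1' := hH.two_mul_deg_le 1
  have hb2 := hH.two_mul_deg_le 2
  have h01 : H.deg 0 ≤ H.deg 1 := hH.deg_mono (by decide)
  have h12 : H.deg 1 ≤ H.deg 2 := hH.deg_mono (by decide)
  have hwb : H.deg 2 ≤ H.relDeg 1 := by omega
  have hu0 := rel_ne_zero hH.constantCoeff_rel 0
  rcases h12.lt_or_eq with hlt | heq
  -- If x_2 occurred in u_0, then b_0 ≥ a_0 + a_2, and N would be at least both a_1 + 2a_2 and a_0 +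
  -- 3a_2 - a_1. Parity matters: a_1 < a_2 and a_1 + a_2 ≥ 12 give a_2 ≥ 8, and then one of the two
  -- bounds exceeds 20.
  · have hfree : ∀ d ∈ (H.rel 0).support, d 2 = 0 := by
      intro d hd
      by_contra hne
      have : H.deg 0 + H.deg 2 ≤ H.relDeg 0 := hH.deg_add_deg_le_of_mem three_pos hd hne
      have hpos := H.deg_pos 0
      obtain ⟨a0, h0⟩ := H.deg_even 0
      obtain ⟨a1, h1⟩ := H.deg_even 1
      obtain ⟨a2, h2⟩ := H.deg_even 2
      omega
    have hpd2 : pderiv 2 (H.rel 0) = 0 := by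
      ext d
      rw [coeff_pderiv, coeff_zero]
      by_cases hd : d + Finsupp.single 2 1 ∈ (H.rel 0).support
      · exact absurd (hfree _ hd) (by simp)
      · rw [notMem_support_iff.1 hd, zero_mul]
    rw [mkDerivation_eq_sum, Fin.sum_univ_three, hp0, hpd2, zero_mul, mul_zero, zero_add,
      add_zero] at hD0
    rcases mul_eq_zero.1 hD0 with hp1 | h
    · have hp2 := last_mem_of_mkDerivation_mem H.deg_ne_zero hH.relDeg_mono H.rel_homogeneous
        H.regularFamily hH.constantCoeff_rel (H.exists_X_pow_mem 2) ht hp' hp0 hp1 hwb hfree hu0 hD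
      refine hδ0 (eq_zero_of_lift hpδ fun i => ?_)
      fin_cases i
      · show p 0 ∈ _; rw [hp0]; exact zero_mem _
      · show p 1 ∈ _; rw [hp1]; exact zero_mem _
      · exact hp2
    · refine hs (splits_of_support (l := 1) (n := 2) (H := H) hH one_pos two_pos fun i d hd j => ?_)
      fin_cases i
      fin_cases j
      · exact eq_zero_of_pderiv_eq_zero h hd
      · exact hfree d hd
  · obtain ⟨e, he⟩ : ∃ e, e + t = H.deg 2 := by
      by_contra! hcon
      refine hδ0 (eq_zero_of_lift hpδ fun i => ?_)
      suffices p i = 0 by rw [this]; exact zero_mem _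
      by_contra hi
      obtain ⟨e, he, -⟩ := hp' i hi
      refine hcon (H.deg 2 - t) (Nat.sub_add_cancel ?_)
      have : H.deg i ≤ H.deg 2 := hH.deg_mono (Fin.le_last i)
      omega
    -- With a_1 = a_2, both values of the derivation have the same degree e, below a_1 and a_2, so
    -- they are multiples of one power of x_0.
    have hform : ∀ i : Fin (2 + 1), H.deg i = H.deg 2 → ∃ c, p i = C c * X 0 ^ (e / H.deg 0) := by
      intro i hi
      by_cases h : p i = 0
      · exact ⟨0, by rw [h, map_zero, zero_mul]⟩
      · obtain ⟨e', he', hhom⟩ := hp' i h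
        obtain rfl : e' = e := by omega
        exact exists_eq_C_mul_X_pow (H.deg_ne_zero 0) (by omega) (by omega) hhom
    obtain ⟨c, hc⟩ := hform 1 heq
    obtain ⟨c', hc'⟩ := hform 2 rfl
    have hmem : c ≠ 0 ∨ c' ≠ 0 → X 0 ^ (e / H.deg 0) ∈ H.relIdeal := by
      intro hcc
      have hM : IsWeightedHomogeneous H.deg (X 0 ^ (e / H.deg 0) : MvPolynomial (Fin 3) ℚ) e := by
        rcases hcc with h | h
        · obtain ⟨e', he', hhom⟩ := hp' 1 (by
            rw [hc]; exact mul_ne_zero (by rwa [Ne, C_eq_zero]) (pow_ne_zero _ (X_ne_zero _)))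
          obtain rfl : e' = e := by omega
          have := hhom.C_mul c⁻¹
          rwa [hc, ← mul_assoc, ← map_mul, inv_mul_cancel₀ h, map_one, one_mul] at this
        · obtain ⟨e', he', hhom⟩ := hp' 2 (by
            rw [hc']; exact mul_ne_zero (by rwa [Ne, C_eq_zero]) (pow_ne_zero _ (X_ne_zero _)))
          obtain rfl : e' = e := by omega
          have := hhom.C_mul c'⁻¹
          rwa [hc', ← mul_assoc, ← map_mul, inv_mul_cancel₀ h, map_one, one_mul] at this
      exact mem_of_mkDerivation_mem H.deg_ne_zero heq hH.relDeg_mono H.rel_homogeneous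
        H.regularFamily hH.constantCoeff_rel H.exists_bound ht he hM hp0 hc hc' hcc hwb hu0 hD
    have hmem' : ∀ r : ℚ, (r ≠ 0 → c ≠ 0 ∨ c' ≠ 0) → C r * X 0 ^ (e / H.deg 0) ∈ H.relIdeal := by
      intro r hr
      by_cases h : r = 0
      · rw [h, map_zero, zero_mul]; exact zero_mem _
      · exact Ideal.mul_mem_left _ _ (hmem (hr h))
    refine hδ0 (eq_zero_of_lift hpδ fun i => ?_)
    fin_cases i
    · show p 0 ∈ _; rw [hp0]; exact zero_mem _
    · show p 1 ∈ _; rw [hc]; exact hmem' c Or.inl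
    · show p 2 ∈ _; rw [hc']; exact hmem' c' Or.inr

end PositivelyElliptic

/-! ### Degree counts for four or more generators -/

namespace PositivelyElliptic

theorem degrees_of_four_generators {H : PositivelyElliptic 4} (hH : H.IsPureModel)
    (hs : ¬ H.Splits) {N : ℕ} (hfd : H.IsFormalDimension N) (hN : N ≤ 20)
    (hdeg : 12 ≤ H.deg 2 + H.deg 3) :
    H.deg 0 = 2 ∧ H.deg 2 = 6 ∧ H.deg 3 = 6 ∧ H.relDeg 1 = 8 ∧ H.relDeg 2 = 12 ∧
      H.relDeg 3 = 12 ∧ (H.deg 1 = 4 ∧ H.relDeg 0 = 6 ∨ H.deg 1 = 2 ∧ H.relDeg 0 = 4) := by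
  have hsum := hH.formalDimension hfd
  rw [Fin.sum_univ_four, Fin.sum_univ_four] at hsum
  have hb0 : H.deg 0 + H.deg 1 ≤ H.relDeg 0 := hH.deg_add_deg_le hs (l := 0) (by norm_num)
  have hb1 : H.deg 0 + H.deg 2 ≤ H.relDeg 1 := hH.deg_add_deg_le hs (l := 1) (by norm_num)
  have hb2 : H.deg 0 + H.deg 3 ≤ H.relDeg 2 := hH.deg_add_deg_le hs (l := 2) (by norm_num)
  have hc1 := hH.two_mul_deg_le 1
  have hc2 := hH.two_mul_deg_le 2
  have hc3 := hH.two_mul_deg_le 3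
  have h01 : H.deg 0 ≤ H.deg 1 := hH.deg_mono (by decide)
  have h12 : H.deg 1 ≤ H.deg 2 := hH.deg_mono (by decide)
  have h23 : H.deg 2 ≤ H.deg 3 := hH.deg_mono (by decide)
  have k01 : H.relDeg 0 ≤ H.relDeg 1 := hH.relDeg_mono (by decide)
  have k12 : H.relDeg 1 ≤ H.relDeg 2 := hH.relDeg_mono (by decide)
  have k23 : H.relDeg 2 ≤ H.relDeg 3 := hH.relDeg_mono (by decide)
  have hpos := H.deg_pos 0
  -- a relation other than the last contains a monomial in the last two variables
  obtain ⟨x, y, hxy, hrel⟩ : ∃ x y, 2 ≤ x + y ∧ (x * H.deg 2 + y * H.deg 3 = H.relDeg 0 ∨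
      x * H.deg 2 + y * H.deg 3 = H.relDeg 1 ∨ x * H.deg 2 + y * H.deg 3 = H.relDeg 2) := by
    obtain ⟨s, hcard, hs⟩ := hH.exists_relations ({2, 3} : Finset (Fin 4))
    obtain ⟨j, hj, hj3⟩ := Finset.exists_mem_ne (hcard : 1 < s.card) 3
    obtain ⟨d, hd, hd2, hd0⟩ := hs j hj
    have e0 := hd0 0 (by decide)
    have e1 := hd0 1 (by decide)
    have hw := relDeg_eq_sum hd
    rw [Finsupp.degree_eq_sum, Fin.sum_univ_four, e0, e1] at hd2
    rw [Fin.sum_univ_four, e0, e1] at hw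
    refine ⟨d 2, d 3, by omega, ?_⟩
    fin_cases j
    · exact Or.inl (by simpa using hw.symm)
    · exact Or.inr (Or.inl (by simpa using hw.symm))
    · exact Or.inr (Or.inr (by simpa using hw.symm))
    · exact absurd rfl hj3
  obtain ⟨a0, h0⟩ := H.deg_even 0
  obtain ⟨a1, h1⟩ := H.deg_even 1
  obtain ⟨a2, h2⟩ := H.deg_even 2
  obtain ⟨a3, h3⟩ := H.deg_even 3
  obtain ⟨b0, g0⟩ := relDeg_even hH.constantCoeff_rel 0
  obtain ⟨b1, g1⟩ := relDeg_even hH.constantCoeff_rel 1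
  obtain ⟨b2, g2⟩ := relDeg_even hH.constantCoeff_rel 2
  obtain ⟨b3, g3⟩ := relDeg_even hH.constantCoeff_rel 3
  -- In terms of actual degrees, `hb0`, `hb1`, `hb2` and `hc3` add up to N ≥ 2|x_0| + 2|x_3|, which
  -- bounds |x_3| by 8. The halved degrees then leave finitely many cases.
  have l0 : a0 = 1 := by omega
  have l2 : 2 ≤ a2 ∧ a2 ≤ 3 := by omega
  have l3 : 3 ≤ a3 ∧ a3 ≤ 4 := by omega
  obtain ⟨l21, l22⟩ := l2
  obtain ⟨l31, l32⟩ := l3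
  rw [h2, h3] at hrel
  interval_cases a2 <;> interval_cases a3 <;> omega

theorem false_of_five_le {k : ℕ} {H : PositivelyElliptic k} (hk : 5 ≤ k) (hH : H.IsPureModel)
    (hs : ¬ H.Splits) {N : ℕ} (hfd : H.IsFormalDimension N) (hN : N ≤ 20)
    (hdeg : 12 ≤ H.deg ⟨k - 2, by omega⟩ + H.deg ⟨k - 1, by omega⟩) : False := by
  obtain ⟨n, rfl⟩ : ∃ n, k = n + 2 := ⟨k - 2, by omega⟩
  have hsum := hH.formalDimension hfd
  -- Extension by 0 makes sums over ranges of naturals available; only indices below n + 2 are ever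
  -- used.
  set a : ℕ → ℕ := fun i => if h : i < n + 2 then H.deg ⟨i, h⟩ else 0 with ha
  set b : ℕ → ℕ := fun i => if h : i < n + 2 then H.relDeg ⟨i, h⟩ else 0 with hb
  have haf : ∀ i (h : i < n + 2), a i = H.deg ⟨i, h⟩ := fun i h => dif_pos h
  have hbf : ∀ i (h : i < n + 2), b i = H.relDeg ⟨i, h⟩ := fun i h => dif_pos h
  have e1 : ∑ i, H.deg i = ∑ i ∈ Finset.range (n + 2), a i := by
    rw [Finset.sum_range]
    exact Finset.sum_congr rfl fun i _ => (haf i i.2).symm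
  have e2 : ∑ i, H.relDeg i = ∑ i ∈ Finset.range (n + 2), b i := by
    rw [Finset.sum_range]
    exact Finset.sum_congr rfl fun i _ => (hbf i i.2).symm
  have hle : ∀ i, i < n + 1 → a 0 + a (i + 1) ≤ b i := by
    intro i hi
    rw [haf 0 (by omega), haf (i + 1) (by omega), hbf i (by omega)]
    exact hH.deg_add_deg_le hs (by omega)
  have hb' : ∀ i, i < n + 2 → 2 * a i ≤ b i := by
    intro i hi
    rw [haf i hi, hbf i hi]
    exact hH.two_mul_deg_le _
  have hpos : 2 ≤ a 0 := by
    rw [haf 0 (by omega)]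
    have := H.deg_pos ⟨0, by omega⟩
    obtain ⟨c, hc⟩ := H.deg_even ⟨0, by omega⟩
    omega
  have hd : 12 ≤ a n + a (n + 1) := by
    rw [haf n (by omega), haf (n + 1) (by omega)]
    exact hdeg
  have hs1 : ∑ i ∈ Finset.range n, (a 0 + a (i + 1)) ≤ ∑ i ∈ Finset.range n, b i :=
    Finset.sum_le_sum fun i hi => hle i (by have := Finset.mem_range.1 hi; omega)
  have hs2 : ∑ i ∈ Finset.range n, a (i + 1) + a 0 = ∑ i ∈ Finset.range n, a i + a n := by
    rw [← Finset.sum_range_succ', Finset.sum_range_succ]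
  rw [Finset.sum_add_distrib, Finset.sum_const, Finset.card_range, smul_eq_mul] at hs1
  rw [e1, e2, Finset.sum_range_succ, Finset.sum_range_succ, Finset.sum_range_succ,
    Finset.sum_range_succ] at hsum
  -- The telescoped sums give N ≥ (n - 1) a_0 + b_n + a_{n+1}, at least 4 + b_n + a_{n+1} as n ≥ 3.
  -- If a_n ≥ 5, use b_n ≥ 2a_n; otherwise a_{n+1} ≥ 8 and b_n ≥ a_0 + a_{n+1}. Both give N > 20.
  have hn : 3 * a 0 ≤ n * a 0 := Nat.mul_le_mul_right _ (by omega)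
  have q1 := hb' n (by omega)
  have q2 := hb' (n + 1) (by omega)
  have q3 := hle n (by omega)
  omega

end PositivelyElliptic

end

theorem proposition5p1 {k : ℕ} (hk : 2 ≤ k) (H : PositivelyElliptic k) (hpure : H.IsPureModel)
    (hsub : ¬ H.Splits)
    (N : ℕ) (hfd : H.IsFormalDimension N) (hN : N ≤ 20)
    (hder : H.HasNegativeDerivation)
    (hdeg : 12 ≤ H.deg ⟨k - 2, by omega⟩ + H.deg ⟨k - 1, by omega⟩) :
    H.degreeType = ([2, 4, 6, 6], [6, 8, 12, 12]) ∨
      H.degreeType = ([2, 2, 6, 6], [4, 8, 12, 12]) := by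
  by_cases h5 : 5 ≤ k
  · exact (PositivelyElliptic.false_of_five_le h5 hpure hsub hfd hN hdeg).elim
  obtain rfl | rfl | rfl : k = 2 ∨ k = 3 ∨ k = 4 := by omega
  · exact (PositivelyElliptic.not_hasNegativeDerivation_two hpure hsub hder).elim
  · exact (PositivelyElliptic.not_hasNegativeDerivation_three hpure hsub hfd hN hdeg hder).elim
  · obtain ⟨h0, h2, h3, g1, g2, g3, h⟩ := PositivelyElliptic.degrees_of_four_generators hpure hsub hfd hN hdeg
    have hd : H.degreeType = ([H.deg 0, H.deg 1, H.deg 2, H.deg 3],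
        [H.relDeg 0, H.relDeg 1, H.relDeg 2, H.relDeg 3]) := by
      simp [PositivelyElliptic.degreeType, List.ofFn_succ]
    rw [hd, h0, h2, h3, g1, g2, g3]
    rcases h with ⟨h1, g0⟩ | ⟨h1, g0⟩
    · exact Or.inl (by rw [h1, g0])
    · exact Or.inr (by rw [h1, g0])
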